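/- **Setting.** Let $M$ be an oriented one-cusped 3-manifold (with torus cusp) with an ideal triangulation $\mathcal T$ with tetrahedra $\Delta_1,\dots,\Delta_N$ and edges $e_1,\dots,e_N$; let $z_1,\dots,z_N\in\mathbb C\setminus\{0,1\}$ be the shape parameters and put $z_j'=\frac1{1-z_j}$, $z_j''=1-\frac1{z_j}$. The parameters $z_j,z_j',z_j''$ are attached to the three pairs of opposite edges of $\Delta_j$, in this cyclic order (counterclockwise as seen from each vertex). Let $\mathbf G_{ij}$ (resp. $\mathbf G'_{ij},\mathbf G''_{ij}$) be the number of edges of $\Delta_j$ that are incident to $e_i$ and carry $z_j$ (resp. $z'_j,z''_j$). For a peripheral curve $\gamma$ let $\mathbf G_\gamma,\mathbf G'_\gamma,\mathbf G''_\gamma$ be obtained from these matrices by replacing the last row by the exponents of the completeness equation of $\gamma$ (each arc of $\gamma$ in a triangle of the cusp contributes $\pm1$ to the exponent of the parameter at the corner that it passes, $+1$ if it turns counterclockwise about the corner and $-1$ otherwise). Put $\mathbf A_\gamma=\mathbf G_\gamma-\mathbf G_\gamma'$, $\mathbf B_\gamma=\mathbf G''_\gamma-\mathbf G'_\gamma$.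 Let $\alpha:\pi_1(M)\to\mathbb Z$ be a morphism and let $\mu,\lambda$ (the meridian and the longitude) be peripheral curves with $\alpha(\mu)=1$, $\alpha(\lambda)=0$. Let $\mathcal T^{(\infty)}$ and $\mathcal T^{(n)}$ be the induced ideal triangulations of the infinite cyclic cover defined by $\ker\alpha$ and of the $n$-fold cyclic cover defined by $\alpha^{-1}(n\mathbb Z)$. Let $t$ be the generator of the deck group $\mathbb Z$ of the infinite cyclic cover that corresponds to $1\in\mathbb Z$ under $\alpha$. Choose lifts $\tilde\Delta_j,\tilde e_i$ of $\Delta_j,e_i$ to $\mathcal T^{(\infty)}$. Let $(\mathbf G_k)_{ij}$ (resp. $(\mathbf G_k')_{ij},(\mathbf G_k'')_{ij}$) be the number of edges of $t^k\tilde\Delta_j$ that are incident to $\tilde e_i$ and carry $z_j$ (resp. $z_j',z_j''$), and let $$\mathbf A(t)=\sum_{k\in\mathbb Z}(\mathbf G_k-\mathbf G_k')t^k,\qquad \mathbf B(t)=\sum_{k\in\mathbb Z}(\mathbf G''_k-\mathbf G_k')t^k .$$ For $\gamma=\mu$ (resp. $\gamma=\lambda$) let $\mathbf A^{(n)}_\gamma,\mathbf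 B^{(n)}_\gamma$ be the matrices $\mathbf A_{\gamma'},\mathbf B_{\gamma'}$ of the triangulation $\mathcal T^{(n)}$, where $\gamma'$ is a closed lift of $\mu^n$ (resp. of $\lambda$) to the $n$-fold cover. Here the tetrahedra $t^k\tilde\Delta_j$ and the edges $t^k\tilde e_i$ of $\mathcal T^{(n)}$ are listed in blocks $k=0,\dots,n-1$, in the order $1,\dots,N$ inside each block, and the replaced row is the last one. Let $\omega=e^{2\pi\sqrt{-1}/n}$ and let $V=(\omega^{ab}I_N)_{0\le a,b\le n-1}$ be the block Vandermonde matrix, which is invertible. A block matrix is called block circulant if its $(a,b)$ block depends only on $b-a$ modulo $n$. **Theorem.** Let $n\ge2$ and $\gamma\in\{\mu,\lambda\}$, and suppose that $\mathbf B^{(n)}_\gamma$ is invertible. Then $\mathbf B_\gamma$ and $\mathbf B(\omega^k)$, $1\le k\le n-1$, are invertible, the matrix $(\mathbf B^{(n)}_\gamma)^{-1}\mathbf A^{(n)}_\gamma$ is block circulant, and $$V^{-1}(\mathbf B^{(n)}_\gamma)^{-1}\mathbf A^{(n)}_\gamma V=\operatorname{diag}\bigl(\mathbf B_\gamma^{-1}\mathbf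 A_\gamma,\ \mathbf B(\omega)^{-1}\mathbf A(\omega),\ \dots,\ \mathbf B(\omega^{n-1})^{-1}\mathbf A(\omega^{n-1})\bigr);$$ equivalently, $$V(\mathbf B^{(n)}_\gamma)^{-1}\mathbf A^{(n)}_\gamma V^{-1}=\operatorname{diag}\bigl(\mathbf B_\gamma^{-1}\mathbf A_\gamma,\ \mathbf B(\omega^{-1})^{-1}\mathbf A(\omega^{-1}),\ \dots,\ \mathbf B(\omega^{-(n-1)})^{-1}\mathbf A(\omega^{-(n-1)})\bigr).$$ **Corollary.** Let moreover $\hbar$ be a formal variable, $\Delta_{z'}=\operatorname{diag}(z'_1,\dots,z'_N)$, and let $\Delta^{(n)}_{z'}$ be the diagonal matrix whose diagonal consists of $n$ copies of $z'_1,\dots,z'_N$. If $-(\mathbf B^{(n)}_\gamma)^{-1}\mathbf A^{(n)}_\gamma+\Delta^{(n)}_{z'}$ is invertible, then so are $-\mathbf B_\gamma^{-1}\mathbf A_\gamma+\Delta_{z'}$ and $-\mathbf B(\omega^k)^{-1}\mathbf A(\omega^k)+\Delta_{z'}$ for $1\le k\le n-1$, and the propagators $$\Pi^{(n)}_\gamma=\hbar\bigl(-(\mathbf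 B^{(n)}_\gamma)^{-1}\mathbf A^{(n)}_\gamma+\Delta^{(n)}_{z'}\bigr)^{-1},\quad \Pi_\gamma=\hbar\bigl(-\mathbf B_\gamma^{-1}\mathbf A_\gamma+\Delta_{z'}\bigr)^{-1},\quad \Pi(s)=\hbar\bigl(-\mathbf B(s)^{-1}\mathbf A(s)+\Delta_{z'}\bigr)^{-1}$$ satisfy $$V^{-1}\,\Pi^{(n)}_\gamma\,V=\operatorname{diag}\bigl(\Pi_\gamma,\Pi(\omega),\dots,\Pi(\omega^{n-1})\bigr),\qquad V\,\Pi^{(n)}_\gamma\,V^{-1}=\operatorname{diag}\bigl(\Pi_\gamma,\Pi(\omega^{-1}),\dots,\Pi(\omega^{-(n-1)})\bigr).$$ -/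

import Mathlib

/-- One of the six (unoriented) edges of a tetrahedron with vertex set `Fin 4`. -/
abbrev TetEdge : Type := {e : Sym2 (Fin 4) // ¬ e.IsDiag}

/-- The image of an edge under a bijection of the vertices. -/
def TetEdge.map (p : Equiv.Perm (Fin 4)) (e : TetEdge) : TetEdge :=
  ⟨e.1.map p, fun h => e.2 ((Sym2.isDiag_map p.injective).1 h)⟩

/-- The edge joining two distinct vertices. -/
def TetEdge.mk (v w : Fin 4) (h : v ≠ w) : TetEdge := ⟨s(v, w), h⟩

/-- The shape parameter carried by an edge: `0`, `1`, `2` stand for `z`, `z' = 1/(1-z)`,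
`z'' = 1 - 1/z`. Opposite edges carry the same parameter, and around every vertex of a tetrahedron
with the orientation given by the vertex order `0,1,2,3`, the parameters are met in the cyclic
order `z, z', z''` (counterclockwise as seen from that vertex). -/
def TetEdge.kind (e : TetEdge) : Fin 3 :=
  if e.1 = s(0, 1) ∨ e.1 = s(2, 3) then 0
  else if e.1 = s(0, 2) ∨ e.1 = s(1, 3) then 1
  else 2

/-- Oriented tetrahedra `Δ_j` (`j : κ`, vertices labelled by `Fin 4`, the order `0,1,2,3` being
positive) whose faces are glued in pairs. The face `f` of a tetrahedron is the one opposite to its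
vertex `f`. It is glued to the face `glue j f f` of `Δ_(nbr j f)`, a vertex `v ≠ f` going to
`glue j f v`. The gluings reverse the orientations of the faces, so that the result is oriented. -/
structure Triangulation (κ : Type*) where
  nbr : κ → Fin 4 → κ
  glue : κ → Fin 4 → Equiv.Perm (Fin 4)
  sign_glue : ∀ j f, Equiv.Perm.sign (glue j f) = -1
  nbr_nbr : ∀ j f, nbr (nbr j f) (glue j f f) = j
  glue_glue : ∀ j f, glue (nbr j f) (glue j f f) = (glue j f)⁻¹
  no_self_gluing : ∀ j f, (nbr j f, glue j f f) ≠ (j, f)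

namespace Triangulation

variable {κ ι : Type*}

/-- An edge of a tetrahedron is identified with its image under the gluing of each of the two
faces that contain it. -/
def EdgeStep (T : Triangulation κ) (x y : κ × TetEdge) : Prop :=
  ∃ f : Fin 4, f ∉ x.2.1 ∧ y = (T.nbr x.1 f, x.2.map (T.glue x.1 f))

/-- The edges of the triangulation: classes of edges of tetrahedra under the equivalence relation
generated by the gluings. -/
def Edge (T : Triangulation κ) : Type _ := Quot T.EdgeStep

/-- The edge of the triangulation to which an edge of a tetrahedron belongs. -/
def edgeOf (T : Triangulation κ) (x : κ × TetEdge) : T.Edge := Quot.mk _ x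

/-- The link of the ideal vertices is a closed oriented surface, with one triangle `(j, v)` for
each vertex `v` of each `Δ_j`, and a side of `(j, v)` for each face `f ≠ v` of `Δ_j`. This is
adjacency of link triangles. -/
def LinkAdj (T : Triangulation κ) (x y : κ × Fin 4) : Prop :=
  ∃ f : Fin 4, f ≠ x.2 ∧ y = (T.nbr x.1 f, T.glue x.1 f x.2)

/-- The link of the ideal vertices is connected, i.e. there is exactly one cusp (then the
triangulated space is connected as well). If there are `N ≥ 1` tetrahedra, then the link has `4N`
triangles, `6N` sides and two vertices for each edge of the triangulation. Hence it is a torus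
iff, moreover, there are exactly `N` edges. -/
def OneCusped (T : Triangulation κ) : Prop :=
  ∀ x y : κ × Fin 4, Relation.ReflTransGen T.LinkAdj x y

/-- A flag `(j, σ)` in `Δ_j` is an ordering `σ 0, σ 1, σ 2, σ 3` of its vertices. -/
abbrev Flag (κ : Type*) : Type _ := κ × Equiv.Perm (Fin 4)

/-- Rotation about an edge: `(j, σ)` stands for the edge `{σ 0, σ 1}` of `Δ_j`, and we leave `Δ_j`
through the face `σ 2` and enter the next tetrahedron around that edge, the face just crossed being
numbered `3` and the other face at the edge being numbered `2`. -/
def rot (T : Triangulation κ) (x : Flag κ) : Flag κ :=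
  (T.nbr x.1 (x.2 2), T.glue x.1 (x.2 2) * x.2 * Equiv.swap 2 3)

/-- An integral cocycle on the dual 2-complex (a spine of the underlying 3-manifold): an integer
for every oriented crossing of a face, such that opposite crossings have opposite integers and the
sum along every closed loop around an edge vanishes. Summing along dual loops gives the morphism
`α : π₁(M) → ℤ`, and each morphism arises so. The cocycle itself (as opposed to its class)
corresponds to a choice of lifts of the tetrahedra to the infinite cyclic cover. -/
structure Cocycle (T : Triangulation κ) where
  c : κ → Fin 4 → ℤ
  antisymm : ∀ j f, c (T.nbr j f) (T.glue j f f) = - c j f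
  edge : ∀ (x : Flag κ) (m : ℕ), T.rot^[m] x = x →
    ∑ i ∈ Finset.range m, c (T.rot^[i] x).1 ((T.rot^[i] x).2 2) = 0

/-- The cyclic cover of `T` defined by `α` and a quotient ring `R` of `ℤ`: the infinite cyclic
cover for `R = ℤ` and the `n`-cyclic cover for `R = ZMod n`. The tetrahedron `(j, k)` is
`t ^ k · Δ̃_j`, where `Δ̃_j` is the chosen lift of `Δ_j` and `t` is the generator of the deck
group. -/
def cover (T : Triangulation ι) (α : T.Cocycle) (R : Type*) [Ring R] :
    Triangulation (ι × R) where
  nbr x f := (T.nbr x.1 f, x.2 + (α.c x.1 f : R))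
  glue x f := T.glue x.1 f
  sign_glue x f := T.sign_glue x.1 f
  nbr_nbr x f := by
    refine Prod.ext (T.nbr_nbr x.1 f) ?_
    simp [α.antisymm]
  glue_glue x f := T.glue_glue x.1 f
  no_self_gluing x f h := T.no_self_gluing x.1 f (by
    simp only [Prod.mk.injEq] at h ⊢
    exact ⟨congrArg Prod.fst h.1, h.2⟩)

/-- A numbering of the edges of `T` by the index set of the tetrahedra (so there are as many edges
as tetrahedra), together with a lift `ẽ_i` of each edge `e_i` to the infinite cyclic cover. The
lift is given by an edge of a tetrahedron `t ^ k · Δ̃_j` of the infinite cyclic cover, as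
`rep i = ((j, k), edge)`. -/
structure EdgeLifts (T : Triangulation ι) where
  rep : ι → (ι × ℤ) × TetEdge
  bijective : Function.Bijective fun i => T.edgeOf ((rep i).1.1, (rep i).2)

/-- The edge `e_i` of `T`. -/
def EdgeLifts.edge {T : Triangulation ι} (E : T.EdgeLifts) (i : ι) : T.Edge :=
  T.edgeOf ((E.rep i).1.1, (E.rep i).2)

/-- The edge `t ^ a · ẽ_i` of the infinite cyclic cover (`R = ℤ`), or its image in the
`n`-cyclic cover (`R = ZMod n`). -/
def EdgeLifts.coverEdge {T : Triangulation ι} (E : T.EdgeLifts) (α : T.Cocycle) (R : Type*)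
    [Ring R] (x : ι × R) : (T.cover α R).Edge :=
  (T.cover α R).edgeOf (((E.rep x.1).1.1, x.2 + ((E.rep x.1).1.2 : R)), (E.rep x.1).2)

/-- A peripheral curve in general position: a closed oriented path in the triangulated link of the
ideal vertices which crosses the link triangles in arcs joining two different sides. The flag
`(j, σ)` stands for an arc in the link triangle at the vertex `σ 0` of `Δ_j`, entering through the
face `σ 2`, leaving through the face `σ 3`, and hence passing the corner that lies on the edge
`{σ 0, σ 1}` of `Δ_j`. -/
structure PeripheralCurve (T : Triangulation κ) where
  len : ℕ
  len_pos : 0 < len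
  flag : ℕ → Flag κ
  periodic : ∀ i, flag (i + len) = flag i
  next_tet : ∀ i, (flag (i + 1)).1 = T.nbr (flag i).1 ((flag i).2 3)
  next_vertex : ∀ i, (flag (i + 1)).2 0 = T.glue (flag i).1 ((flag i).2 3) ((flag i).2 0)
  next_face : ∀ i, (flag (i + 1)).2 2 = T.glue (flag i).1 ((flag i).2 3) ((flag i).2 3)

/-- The value `α(γ)` on (the homotopy class of) a peripheral curve. -/
def Cocycle.eval {T : Triangulation κ} (α : T.Cocycle) (γ : T.PeripheralCurve) : ℤ :=
  ∑ i ∈ Finset.range γ.len, α.c (γ.flag i).1 ((γ.flag i).2 3)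

/-- The corner passed by an arc, as an edge of the tetrahedron. -/
def Flag.corner (x : Flag κ) : TetEdge :=
  TetEdge.mk (x.2 0) (x.2 1) (fun h => absurd (x.2.injective h) (by decide))

/-- The sign of an arc: `+1` if it runs counterclockwise about the corner that it passes (as seen
from the cusp), and `-1` if it runs clockwise. -/
def Flag.turn (x : Flag κ) : ℤ := - (Equiv.Perm.sign x.2 : ℤ)

section Matrices

variable [DecidableEq κ]

open Classical in
/-- The matrices `G, G', G''` (for `q = 0, 1, 2`), where the rows stand for the edges `E i`: the
number of edges of `Δ_j` incident to `E i` that carry the `q`-th shape parameter. -/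
noncomputable def gluing (T : Triangulation κ) (E : κ → T.Edge) (q : Fin 3) : Matrix κ κ ℤ :=
  fun i j => ((Finset.univ.filter fun e : TetEdge => e.kind = q ∧ T.edgeOf (j, e) = E i).card : ℤ)

/-- The exponents of the `q`-th shape parameters in the completeness equation of `γ`: the product
over the arcs of `γ` of the parameter of the corner that is passed, to the power of the sign of
the arc, equals `1`. -/
def cuspRow (T : Triangulation κ) (γ : T.PeripheralCurve) (q : Fin 3) : κ → ℤ :=
  fun j => ∑ i ∈ Finset.range γ.len,
    if (γ.flag i).1 = j ∧ (Flag.corner (γ.flag i)).kind = q then Flag.turn (γ.flag i) else 0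

/-- `G_γ, G'_γ, G''_γ`: the row `last` is replaced by the completeness equation of `γ`. -/
noncomputable def gluingCusp (T : Triangulation κ) (E : κ → T.Edge) (last : κ)
    (γ : T.PeripheralCurve) (q : Fin 3) : Matrix κ κ ℤ :=
  (T.gluing E q).updateRow last (T.cuspRow γ q)

/-- The Neumann–Zagier matrix `A_γ = G_γ - G'_γ`, with complex entries. -/
noncomputable def nzA (T : Triangulation κ) (E : κ → T.Edge) (last : κ)
    (γ : T.PeripheralCurve) : Matrix κ κ ℂ :=
  (T.gluingCusp E last γ 0 - T.gluingCusp E last γ 1).map (Int.castRingHom ℂ)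

/-- The Neumann–Zagier matrix `B_γ = G''_γ - G'_γ`, with complex entries. -/
noncomputable def nzB (T : Triangulation κ) (E : κ → T.Edge) (last : κ)
    (γ : T.PeripheralCurve) : Matrix κ κ ℂ :=
  (T.gluingCusp E last γ 2 - T.gluingCusp E last γ 1).map (Int.castRingHom ℂ)

end Matrices

section Twisted

variable (T : Triangulation ι) (α : T.Cocycle) (E : T.EdgeLifts)

/-- The matrices `G_k, G'_k, G''_k` (for `q = 0, 1, 2`): the `(i, j)` entry is the number of edges
of `t ^ k · Δ̃_j` which are incident to `ẽ_i` in the infinite cyclic cover and carry the `q`-th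
shape parameter. -/
noncomputable def gluingAt (q : Fin 3) (k : ℤ) : Matrix ι ι ℤ :=
  fun i j => (T.cover α ℤ).gluing (E.coverEdge α ℤ) q (i, 0) (j, k)

/-- The twisted Neumann–Zagier matrix `A(t) = ∑_k (G_k - G'_k) t ^ k` over `ℤ[t, t⁻¹]`; only
finitely many summands are nonzero. -/
noncomputable def twistedA : Matrix ι ι (LaurentPolynomial ℤ) :=
  fun i j => ∑ᶠ k : ℤ,
    LaurentPolynomial.C (T.gluingAt α E 0 k i j - T.gluingAt α E 1 k i j) * LaurentPolynomial.T k

/-- The twisted Neumann–Zagier matrix `B(t) = ∑_k (G''_k - G'_k) t ^ k` over `ℤ[t, t⁻¹]`; only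
finitely many summands are nonzero. -/
noncomputable def twistedB : Matrix ι ι (LaurentPolynomial ℤ) :=
  fun i j => ∑ᶠ k : ℤ,
    LaurentPolynomial.C (T.gluingAt α E 2 k i j - T.gluingAt α E 1 k i j) * LaurentPolynomial.T k

/-- Evaluation of a matrix of Laurent polynomials at a nonzero complex number. -/
noncomputable def evalAt (X : Matrix ι ι (LaurentPolynomial ℤ)) (s : ℂˣ) : Matrix ι ι ℂ :=
  X.map (LaurentPolynomial.eval₂ (Int.castRingHom ℂ) s)

end Twisted

section Lift

variable {T : Triangulation ι}

theorem PeripheralCurve.sum_add_len (γ : T.PeripheralCurve) {R : Type*} [AddCommMonoid R]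
    (g : Flag ι → R) (d i : ℕ) :
    ∑ l ∈ Finset.range (i + d * γ.len), g (γ.flag l) =
      ∑ l ∈ Finset.range i, g (γ.flag l) + d • ∑ l ∈ Finset.range γ.len, g (γ.flag l) := by
  have one : ∀ i : ℕ, ∑ l ∈ Finset.range (i + γ.len), g (γ.flag l) =
      ∑ l ∈ Finset.range i, g (γ.flag l) + ∑ l ∈ Finset.range γ.len, g (γ.flag l) := by
    intro i
    induction i with
    | zero => simp
    | succ i ih =>
      rw [Nat.add_right_comm, Finset.sum_range_succ, ih, γ.periodic, Finset.sum_range_succ]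
      exact add_right_comm _ _ _
  induction d with
  | zero => simp
  | succ d ih => rw [Nat.succ_mul, ← Nat.add_assoc, one, ih, succ_nsmul, add_assoc]

theorem PeripheralCurve.flag_add_mul_len (γ : T.PeripheralCurve) (d i : ℕ) :
    γ.flag (i + d * γ.len) = γ.flag i := by
  induction d with
  | zero => simp
  | succ d ih => rw [Nat.succ_mul, ← Nat.add_assoc, γ.periodic, ih]

/-- The peripheral curve of the `n`-cyclic cover represented by `γ`: the lift, starting in the
sheet `k₀`, of the smallest positive power `γ ^ d` that lifts to a closed curve, i.e. `d` is the
order of `α(γ)` in `ℤ/n`. So this is a lift of `γ ^ n` if `α(γ) = 1` and of `γ` if `α(γ) = 0`. -/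
noncomputable def PeripheralCurve.lift (γ : T.PeripheralCurve) (α : T.Cocycle) (n : ℕ) [NeZero n]
    (k₀ : ZMod n) : (T.cover α (ZMod n)).PeripheralCurve where
  len := addOrderOf (α.eval γ : ZMod n) * γ.len
  len_pos := Nat.mul_pos (addOrderOf_pos _) γ.len_pos
  flag i := (((γ.flag i).1,
    k₀ + ∑ l ∈ Finset.range i, (α.c (γ.flag l).1 ((γ.flag l).2 3) : ZMod n)), (γ.flag i).2)
  periodic i := by
    have h := γ.sum_add_len (fun x => (α.c x.1 (x.2 3) : ZMod n))
      (addOrderOf (α.eval γ : ZMod n)) i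
    have h0 : ∑ l ∈ Finset.range γ.len, (α.c (γ.flag l).1 ((γ.flag l).2 3) : ZMod n) =
        (α.eval γ : ZMod n) := by simp [Cocycle.eval]
    rw [h0, addOrderOf_nsmul_eq_zero, add_zero] at h
    rw [h, γ.flag_add_mul_len]
  next_tet i := by
    refine Prod.ext (γ.next_tet i) ?_
    simp [cover, Finset.sum_range_succ, add_assoc]
  next_vertex i := γ.next_vertex i
  next_face i := γ.next_face i

end Lift

end Triangulation

section LinearAlgebra

variable {κ ι : Type*}

/-- The propagator `ħ (-B⁻¹ A + Δ_{z'})⁻¹`, where `z' = 1/(1-z)` and `ħ` is a formal variable. -/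
noncomputable def propagator [Fintype κ] [DecidableEq κ] (A B : Matrix κ κ ℂ) (z : κ → ℂ) :
    Matrix κ κ (PowerSeries ℂ) :=
  (PowerSeries.X : PowerSeries ℂ) •
    ((-(B⁻¹ * A) + Matrix.diagonal fun j => 1 / (1 - z j))⁻¹).map (PowerSeries.C (R := ℂ))

/-- `ω = exp(2π√-1/n)`. -/
noncomputable def rootOmega (n : ℕ) : ℂˣ :=
  Units.mk0 (Complex.exp (2 * Real.pi * Complex.I / n)) (Complex.exp_ne_zero _)

/-- The block Vandermonde matrix: the blocks are indexed by `a, b ∈ {0, …, n-1}` (residues modulo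
`n`), and the `(a, b)` block is `ω ^ (a b)` times the identity. An index `(i, a)` is the position
`i` in the block `a`. -/
noncomputable def blockVandermonde (ι : Type*) [DecidableEq ι] (n : ℕ) :
    Matrix (ι × ZMod n) (ι × ZMod n) ℂ :=
  fun x y => if x.1 = y.1 then (rootOmega n : ℂ) ^ (x.2.val * y.2.val) else 0

/-- Block circulant: there are `C_0, …, C_{n-1}` such that the `(a, b)` block is `C_{b-a}`. -/
def IsBlockCirculant {n : ℕ} (M : Matrix (ι × ZMod n) (ι × ZMod n) ℂ) : Prop :=
  ∃ C : ZMod n → Matrix ι ι ℂ, ∀ i a j b, M (i, a) (j, b) = C (b - a) i j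

end LinearAlgebra

/-! Put `X = Bn⁻¹ * An`. Before a row is replaced, the edge matrices `G₁` (for A) and `G₂` (for B)
of the cover are block circulant: deck transformations permute edges and tetrahedra. The replaced
row breaks this symmetry, and the main point is that `X` keeps it.

Each column of `G₁` and of `G₂` sums to zero, so the discarded edge equation follows from the others
and `G₂ * X = G₁` (`mul_inv_mul_updateRow`). If `τ` is a deck shift, the difference `D` of the
shifted `X` and `X` satisfies `G₂ * D = 0`. Since `Bn` is invertible, the kernel of `G₂` is at most
a line, and `D = vecMulVec u v`. Shifting preserves the trace, so `v ⬝ᵥ u = 0` and `D * D = 0`. The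
Neumann–Zagier relations make the real matrix `X` symmetric, hence `D` is Hermitian and vanishes
(`eq_zero_of_mul_eq_zero_of_trace`).

The symplectic relations (`gluingDiff_mul_transpose`, `gluingDiff_mulVec_cuspDiff`) come from one
local identity: the signed pairing of a corner with a function on the edges of its tetrahedron is a
difference of two terms, one for each face at the corner. These cancel around an edge and along a
closed curve.

Once `X` is block circulant, the Fourier transform turns `G₂ * X = G₁` into one equation per
frequency. For `k ≠ 0` this is the twisted equation at `ω ^ k`; for `k = 0` the cusp row is
recovered by summing over the sheets. The blocks are identified with values of A(t), B(t) through a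
height function on edges (`exists_height`), which exists because the deck group acts freely on the
edges of the infinite cyclic cover. -/

/-! ### Edges of a tetrahedron and permutations of its vertices -/

namespace TetEdge

@[simp] theorem map_val (p : Equiv.Perm (Fin 4)) (e : TetEdge) : (e.map p).1 = e.1.map p := rfl

theorem map_mul (p q : Equiv.Perm (Fin 4)) (e : TetEdge) : e.map (p * q) = (e.map q).map p := by
  apply Subtype.ext
  simp [Sym2.map_map, Equiv.Perm.coe_mul]

@[simp] theorem map_one (e : TetEdge) : e.map 1 = e := by
  apply Subtype.ext
  simp

/-- The edge joining the first two vertices. -/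
def base : TetEdge := ⟨s(0, 1), by decide⟩

theorem mem_map (p : Equiv.Perm (Fin 4)) (e : TetEdge) (f : Fin 4) :
    p f ∈ (e.map p).1 ↔ f ∈ e.1 := by
  simp [Sym2.mem_map]

theorem exists_map_base (e : TetEdge) : ∃ p : Equiv.Perm (Fin 4), base.map p = e := by
  revert e
  decide +kernel

/-- The vertices outside the edge of a flag are the last two. -/
theorem notMem_base (f : Fin 4) : f ∉ base.1 ↔ f = 2 ∨ f = 3 := by
  revert f
  decide +kernel

/-- Exchanging both the ends of an edge and the two faces at the edge. -/
def reversal : Equiv.Perm (Fin 4) := Equiv.swap 0 1 * Equiv.swap 2 3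

theorem eq_one_or_reversal (p : Equiv.Perm (Fin 4)) (h : base.map p = base)
    (hs : Equiv.Perm.sign p = 1) : p = 1 ∨ p = reversal := by
  revert p
  decide +kernel

end TetEdge

/-! ### Rotation of flags about edges -/

namespace Triangulation

open TetEdge

variable {κ ι : Type*} (T : Triangulation κ)

theorem Flag.corner_eq (x : Flag κ) : Flag.corner x = base.map x.2 := rfl

/-- The same edge with the opposite direction, and with the opposite direction of rotation. -/
def Flag.rev (x : Flag κ) : Flag κ := (x.1, x.2 * reversal)

theorem Flag.rev_rev (x : Flag κ) : x.rev.rev = x := by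
  have : reversal * reversal = 1 := by decide +kernel
  simp [Flag.rev, mul_assoc, this]

/-- The reversed flag leaves through the face just crossed, so the second rotation returns to the
initial tetrahedron. Thus rotation and reversal generate a dihedral action. -/
theorem rot_rev_rot (x : Flag κ) : T.rot (T.rot x).rev = x.rev := by
  obtain ⟨j, σ⟩ := x
  have h1 : (T.glue j (σ 2) * σ * Equiv.swap 2 3 * reversal : Equiv.Perm (Fin 4)) 2 = T.glue j (σ 2) (σ 2) := by
    have : Equiv.swap 2 3 (reversal 2) = 2 := by decide +kernel
    simp only [Equiv.Perm.mul_apply, this]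
  have h2 : Equiv.swap (2 : Fin 4) 3 * reversal * Equiv.swap 2 3 = reversal := by decide +kernel
  simp only [rot, Flag.rev, h1, T.nbr_nbr, T.glue_glue]
  refine Prod.ext rfl ?_
  calc _ = σ * (Equiv.swap (2 : Fin 4) 3 * reversal * Equiv.swap 2 3) := by group
    _ = _ := by rw [h2]

/-- The rotation about edges as a permutation of the flags. -/
def rotPerm : Equiv.Perm (Flag κ) where
  toFun := T.rot
  invFun x := (T.rot x.rev).rev
  left_inv x := by
    have h := T.rot_rev_rot x
    simp only [h, Flag.rev_rev]
  right_inv x := by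
    simp only [T.rot_rev_rot, Flag.rev_rev]

theorem rotPerm_apply (x : Flag κ) : T.rotPerm x = T.rot x := rfl

/-- `Flag.rev` as a permutation. -/
def revPerm (κ : Type*) : Equiv.Perm (Flag κ) where
  toFun := Flag.rev
  invFun := Flag.rev
  left_inv := Flag.rev_rev
  right_inv := Flag.rev_rev

theorem revPerm_conj_zpow (m : ℤ) :
    revPerm κ * T.rotPerm ^ m = T.rotPerm ^ (-m) * revPerm κ := by
  have h : revPerm κ * T.rotPerm * (revPerm κ)⁻¹ = T.rotPerm⁻¹ := by
    rw [eq_inv_iff_mul_eq_one]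
    ext1 x
    change (T.rot (T.rot x).rev).rev = x
    rw [T.rot_rev_rot, Flag.rev_rev]
  rw [zpow_neg, ← inv_zpow, ← h, conj_zpow]
  group

theorem Flag.rev_ne (x : Flag κ) : x.rev ≠ x := by
  intro h
  have h2 : reversal = 1 := by
    have := congrArg Prod.snd h
    simpa [Flag.rev] using this
  exact absurd h2 (by decide +kernel)

theorem rot_ne_rev (x : Flag κ) : T.rot x ≠ x.rev := by
  obtain ⟨j, σ⟩ := x
  intro h
  simp only [rot, Flag.rev, Prod.mk.injEq] at h
  refine T.no_self_gluing j (σ 2) (Prod.ext h.1 ?_)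
  have h3 := DFunLike.congr_fun h.2 3
  have e1 : Equiv.swap (2 : Fin 4) 3 3 = 2 := by decide +kernel
  have e2 : reversal 3 = 2 := by decide +kernel
  simpa only [Equiv.Perm.mul_apply, e1, e2] using h3

/-- No edge is folded onto itself. -/
theorem rotPerm_zpow_ne_rev (m : ℤ) (x : Flag κ) : (T.rotPerm ^ m) x ≠ x.rev := by
  intro h
  -- Halving `m` moves the coincidence to a single flag: for even `m` a flag equals its reverse, for
  -- odd `m` one rotation reverses it, which would glue a face to itself.
  have key : ∀ l : ℤ, (T.rotPerm ^ (m - l)) x = ((T.rotPerm ^ l) x).rev := by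
    intro l
    have h1 := DFunLike.congr_fun (T.revPerm_conj_zpow l) x
    change ((T.rotPerm ^ l) x).rev = (T.rotPerm ^ (-l)) x.rev at h1
    rw [h1, ← h, ← Equiv.Perm.mul_apply, ← zpow_add]
    congr 2
    ring
  rcases Int.even_or_odd' m with ⟨l, rfl | rfl⟩
  · refine Flag.rev_ne ((T.rotPerm ^ l) x) ?_
    rw [← key l]
    congr 2
    ring
  · refine T.rot_ne_rev ((T.rotPerm ^ l) x) ?_
    rw [← key l, ← rotPerm_apply, ← Equiv.Perm.mul_apply, ← zpow_one_add]
    congr 2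
    ring

theorem sign_rot (x : Flag κ) : Equiv.Perm.sign (T.rot x).2 = Equiv.Perm.sign x.2 := by
  have : Equiv.Perm.sign (Equiv.swap (2 : Fin 4) 3) = -1 := Equiv.Perm.sign_swap (by decide)
  simp [rot, T.sign_glue, this]

theorem sign_rotPerm_zpow (m : ℤ) (x : Flag κ) :
    Equiv.Perm.sign ((T.rotPerm ^ m) x).2 = Equiv.Perm.sign x.2 := by
  induction m using Int.induction_on with
  | zero => rfl
  | succ i ih => rw [add_comm, zpow_one_add, Equiv.Perm.mul_apply, rotPerm_apply, sign_rot, ih]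
  | pred i ih =>
    rw [← ih, ← T.sign_rot, ← rotPerm_apply, ← Equiv.Perm.mul_apply, ← zpow_one_add]
    congr 4
    ring

theorem corner_rot (x : Flag κ) :
    Flag.corner (T.rot x) = (Flag.corner x).map (T.glue x.1 (x.2 2)) := by
  have : base.map (Equiv.swap 2 3) = base := by decide +kernel
  simp only [Flag.corner_eq, rot, map_mul, this]

theorem edgeStep_rot (x : Flag κ) :
    T.EdgeStep (x.1, Flag.corner x) ((T.rot x).1, Flag.corner (T.rot x)) := by
  refine ⟨x.2 2, ?_, ?_⟩
  · rw [Flag.corner_eq, mem_map]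
    decide +kernel
  · rw [corner_rot]
    rfl

theorem corner_rev (x : Flag κ) : Flag.corner x.rev = Flag.corner x := by
  have : base.map reversal = base := by decide +kernel
  simp only [Flag.corner_eq, Flag.rev, map_mul, this]

/-- Of the two faces at the edge of a flag, one is crossed by the rotation and the other by its
inverse. Hence an edge class is a single rotation orbit. -/
theorem EdgeStep.exists_zpow {T : Triangulation κ} {x : Flag κ} {y : κ × TetEdge}
    (h : T.EdgeStep (x.1, Flag.corner x) y) :
    ∃ m : ℤ, (((T.rotPerm ^ m) x).1, Flag.corner ((T.rotPerm ^ m) x)) = y := by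
  obtain ⟨f, hf, rfl⟩ := h
  obtain ⟨g, rfl⟩ := x.2.surjective f
  rw [Flag.corner_eq, mem_map, notMem_base] at hf
  rcases hf with rfl | rfl
  · refine ⟨1, ?_⟩
    rw [zpow_one, rotPerm_apply, corner_rot]
    rfl
  · refine ⟨-1, ?_⟩
    have h3 : x.rev.2 2 = x.2 3 := by
      have : reversal 2 = 3 := by decide +kernel
      simp only [Flag.rev, Equiv.Perm.mul_apply, this]
    have : (T.rotPerm ^ (-1 : ℤ)) x = (T.rot x.rev).rev := by
      rw [zpow_neg_one]
      rfl
    rw [this, corner_rev, corner_rot, corner_rev, h3]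
    refine Prod.ext ?_ rfl
    change T.nbr x.1 (x.rev.2 2) = _
    rw [h3]

theorem EdgeStep.symm {T : Triangulation κ} {x y : κ × TetEdge} (h : T.EdgeStep x y) :
    T.EdgeStep y x := by
  obtain ⟨f, hf, rfl⟩ := h
  refine ⟨T.glue x.1 f f, by rwa [mem_map], ?_⟩
  simp only [T.nbr_nbr, T.glue_glue, ← map_mul, inv_mul_cancel, map_one]

theorem edgeOf_nbr (j : κ) (f : Fin 4) (e : TetEdge) (h : f ∉ e.1) :
    T.edgeOf (T.nbr j f, e.map (T.glue j f)) = T.edgeOf (j, e) :=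
  (Quot.sound ⟨f, h, rfl⟩ : T.edgeOf (j, e) = _).symm

theorem edgeOf_eq_iff {x y : κ × TetEdge} :
    T.edgeOf x = T.edgeOf y ↔ Relation.ReflTransGen T.EdgeStep x y := by
  constructor
  · intro h
    have h1 := Quot.eqvGen_exact h
    clear h
    induction h1 with
    | rel x y h => exact .single h
    | refl x => exact .refl
    | symm x y _ ih =>
      have : Std.Symm T.EdgeStep := ⟨fun _ _ => EdgeStep.symm⟩
      exact Relation.ReflTransGen.stdSymm.symm _ _ ih
    | trans x y z _ _ ih1 ih2 => exact ih1.trans ih2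
  · intro h
    induction h with
    | refl => rfl
    | tail _ h ih => exact ih.trans (Quot.sound h)

theorem exists_zpow_of_edgeOf_eq (x : Flag κ) (y : κ × TetEdge)
    (h : T.edgeOf (x.1, Flag.corner x) = T.edgeOf y) :
    ∃ m : ℤ, (((T.rotPerm ^ m) x).1, Flag.corner ((T.rotPerm ^ m) x)) = y := by
  rw [edgeOf_eq_iff] at h
  induction h with
  | refl => exact ⟨0, rfl⟩
  | tail _ h ih =>
    obtain ⟨m, hm⟩ := ih
    rw [← hm] at h
    obtain ⟨l, hl⟩ := h.exists_zpow
    refine ⟨l + m, ?_⟩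
    rw [zpow_add, Equiv.Perm.mul_apply]
    exact hl

/-! ### Freeness of the deck action on edges -/

section Cover

variable (T : Triangulation ι) (α : T.Cocycle)

theorem cover_rot_iterate {R : Type*} [Ring R] (m : ℕ) (j : ι) (k : R) (σ : Equiv.Perm (Fin 4)) :
    (T.cover α R).rot^[m] ((j, k), σ) =
      (((T.rot^[m] (j, σ)).1, k + ((∑ i ∈ Finset.range m,
        α.c (T.rot^[i] (j, σ)).1 ((T.rot^[i] (j, σ)).2 2) : ℤ) : R)), (T.rot^[m] (j, σ)).2) := by
  induction m with
  | zero => simp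
  | succ m ih =>
    rw [Function.iterate_succ_apply', ih, Function.iterate_succ_apply', Finset.sum_range_succ,
      Int.cast_add, ← add_assoc]
    rfl

/-- A nontrivial deck transformation of the infinite cyclic cover fixes no edge. -/
theorem cover_edgeOf_injective (j : ι) (e : TetEdge) (k k' : ℤ)
    (h : (T.cover α ℤ).edgeOf ((j, k), e) = (T.cover α ℤ).edgeOf ((j, k'), e)) : k = k' := by
  obtain ⟨σ, rfl⟩ := exists_map_base e
  -- If the flag returns to itself downstairs, the rotation is a loop around an edge, on which the
  -- cocycle sums to zero.
  have main : ∀ (m : ℕ) (k k' : ℤ) (τ τ' : Equiv.Perm (Fin 4)),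
      ((T.cover α ℤ).rotPerm ^ (m : ℤ)) ((j, k), τ) = ((j, k'), τ') →
      (T.rotPerm ^ (m : ℤ)) (j, τ) = (j, τ') ∧ (τ = τ' → k = k') := by
    intro m k k' τ τ' hm
    have h1 : (T.cover α ℤ).rot^[m] ((j, k), τ) = ((j, k'), τ') := by
      rw [← hm, zpow_natCast, ← Equiv.Perm.iterate_eq_pow]
      rfl
    rw [cover_rot_iterate] at h1
    simp only [Prod.mk.injEq] at h1
    have h3 : T.rot^[m] (j, τ) = (j, τ') := Prod.ext h1.1.1 h1.2
    refine ⟨?_, ?_⟩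
    · rw [zpow_natCast, ← Equiv.Perm.iterate_eq_pow]
      exact h3
    · rintro rfl
      simpa [α.edge (j, τ) m h3] using h1.1.2
  obtain ⟨m, hm⟩ := (T.cover α ℤ).exists_zpow_of_edgeOf_eq ((j, k), σ) _ h
  have hs := (T.cover α ℤ).sign_rotPerm_zpow m ((j, k), σ)
  obtain ⟨τ, hy⟩ : ∃ τ, ((T.cover α ℤ).rotPerm ^ m) ((j, k), σ) = ((j, k'), τ) :=
    ⟨_, Prod.ext (congrArg (fun y => y.1) hm :) rfl⟩
  rw [hy] at hm hs
  have hc : base.map τ = base.map σ := congrArg Prod.snd hm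
  -- Rotation preserves the sign of a flag, which leaves only two flags on the same edge. The
  -- reversed one is excluded below by `rotPerm_zpow_ne_rev`.
  have hτ : τ = σ ∨ τ = σ * reversal := by
    rcases eq_one_or_reversal (σ⁻¹ * τ) (by
      rw [TetEdge.map_mul, hc, ← TetEdge.map_mul, inv_mul_cancel, map_one])
      (by simpa using by simp [show Equiv.Perm.sign τ = Equiv.Perm.sign σ from hs]) with h | h
    · exact .inl (by rw [← mul_one σ, ← h, mul_inv_cancel_left])
    · exact .inr (by rw [← h, mul_inv_cancel_left])
  obtain ⟨p, rfl | rfl⟩ := m.eq_nat_or_neg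
  · obtain ⟨h1, h2⟩ := main p k k' σ τ hy
    rcases hτ with rfl | rfl
    · exact h2 rfl
    · exact absurd h1 (T.rotPerm_zpow_ne_rev p (j, σ))
  · have hy' : ((T.cover α ℤ).rotPerm ^ (p : ℤ)) ((j, k'), τ) = ((j, k), σ) := by
      rw [← hy, ← Equiv.Perm.mul_apply, ← zpow_add, add_neg_cancel, zpow_zero,
        Equiv.Perm.one_apply]
    obtain ⟨h1, h2⟩ := main p k' k τ σ hy'
    rcases hτ with rfl | rfl
    · exact (h2 rfl).symm
    · refine absurd h1 ?_
      have h3 := T.rotPerm_zpow_ne_rev p (Flag.rev (j, σ))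
      rw [Flag.rev_rev] at h3
      exact h3

end Cover

end Triangulation

/-! ### The local symplectic identity in a tetrahedron -/

namespace TetEdge

/-- The exponent of an edge of a given kind in the difference of the `q`-th and of the first
gluing matrix. -/
def kindDiff (q : Fin 3) (e : TetEdge) : ℤ :=
  (if e.kind = q then 1 else 0) - (if e.kind = 1 then 1 else 0)

theorem sum_kindDiff (q : Fin 3) : ∑ e, kindDiff q e = 0 := by
  revert q
  decide +kernel

theorem card_map_base (e : TetEdge) :
    (Finset.univ.filter fun σ : Equiv.Perm (Fin 4) => base.map σ = e).card = 4 := by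
  revert e
  decide +kernel

theorem sum_map_base (g : TetEdge → ℤ) :
    ∑ σ : Equiv.Perm (Fin 4), g (base.map σ) = 4 * ∑ e, g e := by
  rw [← Finset.sum_fiberwise_of_maps_to (s := Finset.univ) (t := Finset.univ)
    (g := fun σ : Equiv.Perm (Fin 4) => base.map σ) (fun _ _ => Finset.mem_univ _), Finset.mul_sum]
  refine Finset.sum_congr rfl fun e _ => ?_
  rw [Finset.sum_congr rfl (g := fun _ => g e) (fun σ hσ => by rw [(Finset.mem_filter.1 hσ).2]),
    Finset.sum_const, card_map_base]
  simp

/-- The antisymmetric pairing of the kinds of two edges. -/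
def pairing (c e : TetEdge) : ℤ := kindDiff 0 c * kindDiff 2 e - kindDiff 2 c * kindDiff 0 e

/-- The edge joining the vertices `0` and `2`. -/
def base₀₂ : TetEdge := ⟨s(0, 2), by decide⟩

/-- The edge joining the vertices `1` and `2`. -/
def base₁₂ : TetEdge := ⟨s(1, 2), by decide⟩

/-- For the face opposite to `σ 3` and its vertex `σ 0`: the sum of `F` over the two sides at that
vertex, minus the value at the third side. -/
def faceSum (F : TetEdge → ℤ) (σ : Equiv.Perm (Fin 4)) : ℤ :=
  F (base.map σ) + F (base₀₂.map σ) - F (base₁₂.map σ)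

/-- A finite check. The two terms on the right belong to the faces opposite to `σ 2` and `σ 3`,
which meet at the corner; each involves only the sides of its face, so it can be transported across
the gluing. -/
theorem sign_mul_pairing (σ : Equiv.Perm (Fin 4)) (e : TetEdge) :
    (Equiv.Perm.sign σ : ℤ) * pairing (base.map σ) e =
      faceSum (fun x => if x = e then 1 else 0) (σ * Equiv.swap 2 3) -
        faceSum (fun x => if x = e then 1 else 0) σ := by
  revert σ e
  decide +kernel

theorem sign_mul_sum_pairing (σ : Equiv.Perm (Fin 4)) (F : TetEdge → ℤ) :
    (Equiv.Perm.sign σ : ℤ) * ∑ e, pairing (base.map σ) e * F e =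
      faceSum F (σ * Equiv.swap 2 3) - faceSum F σ := by
  rw [Finset.mul_sum]
  simp only [← mul_assoc, sign_mul_pairing]
  simp [faceSum, sub_mul, add_mul, Finset.sum_sub_distrib, Finset.sum_add_distrib]

theorem faceSum_mul_swap (F : TetEdge → ℤ) (σ : Equiv.Perm (Fin 4)) :
    faceSum F (σ * Equiv.swap 1 2) = faceSum F σ := by
  have h1 : base.map (Equiv.swap 1 2) = base₀₂ := by decide +kernel
  have h2 : base₀₂.map (Equiv.swap 1 2) = base := by decide +kernel
  have h3 : base₁₂.map (Equiv.swap 1 2) = base₁₂ := by decide +kernel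
  simp only [faceSum, map_mul, h1, h2, h3]
  ring

theorem eq_one_or_swap (p : Equiv.Perm (Fin 4)) (h0 : p 0 = 0) (h3 : p 3 = 3) :
    p = 1 ∨ p = Equiv.swap 1 2 := by
  revert p
  decide +kernel

end TetEdge

/-! ### The Neumann–Zagier symplectic relations -/

namespace Triangulation

open TetEdge

section Symplectic

variable {κ : Type*} (T : Triangulation κ)

/-- `G_q - G_1`, for the gluing matrices `G_0 = G`, `G_1 = G'`, `G_2 = G''`. -/
noncomputable def gluingDiff (E : κ → T.Edge) (q : Fin 3) : Matrix κ κ ℤ :=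
  T.gluing E q - T.gluing E 1

open Classical in
/-- The indicator function of an edge of the triangulation on the edges of a tetrahedron. -/
noncomputable def edgeInd (e : T.Edge) (j : κ) (x : TetEdge) : ℤ :=
  if T.edgeOf (j, x) = e then 1 else 0

theorem edgeInd_congr (e : T.Edge) {j j' : κ} {x x' : TetEdge}
    (h : T.edgeOf (j, x) = T.edgeOf (j', x')) : T.edgeInd e j x = T.edgeInd e j' x' := by
  rw [edgeInd, edgeInd, h]

theorem gluingDiff_apply (E : κ → T.Edge) (q : Fin 3) (i j : κ) :
    T.gluingDiff E q i j = ∑ e, kindDiff q e * T.edgeInd (E i) j e := by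
  classical
  simp only [gluingDiff, Matrix.sub_apply, gluing, Finset.card_filter, Nat.cast_sum,
    ← Finset.sum_sub_distrib]
  refine Finset.sum_congr rfl fun e _ => ?_
  by_cases h : T.edgeOf (j, e) = E i <;> simp [h, kindDiff, edgeInd]

theorem faceSum_nbr (e : T.Edge) (j : κ) (σ : Equiv.Perm (Fin 4)) :
    faceSum (T.edgeInd e (T.nbr j (σ 3))) (T.glue j (σ 3) * σ) = faceSum (T.edgeInd e j) σ := by
  have h : ∀ x : TetEdge, 3 ∉ x.1 →
      T.edgeInd e (T.nbr j (σ 3)) (x.map (T.glue j (σ 3) * σ)) = T.edgeInd e j (x.map σ) := by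
    intro x hx
    rw [TetEdge.map_mul, edgeInd, T.edgeOf_nbr _ _ _ (by rwa [mem_map])]
    rfl
  unfold faceSum
  rw [h _ (by decide +kernel), h _ (by decide +kernel), h _ (by decide +kernel)]

/-- The edge equations are symplectically orthogonal to each other. -/
theorem gluingDiff_mul_transpose [Fintype κ] (E : κ → T.Edge) :
    T.gluingDiff E 0 * (T.gluingDiff E 2).transpose =
      T.gluingDiff E 2 * (T.gluingDiff E 0).transpose := by
  ext i i'
  simp only [Matrix.mul_apply, Matrix.transpose_apply]
  rw [← sub_eq_zero, ← Finset.sum_sub_distrib]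
  -- Each edge of a tetrahedron underlies four flags, so a sum over flags counts it four times.
  suffices h : 4 * ∑ j, (T.gluingDiff E 0 i j * T.gluingDiff E 2 i' j -
      T.gluingDiff E 2 i j * T.gluingDiff E 0 i' j) = 0 by simpa using h
  set F := T.edgeInd (E i')
  set w : Flag κ → ℤ := fun x => T.edgeInd (E i) x.1 (base.map x.2) * (Equiv.Perm.sign x.2 : ℤ)
    with hw
  have hwrot : ∀ x, w (T.rot x) = w x := by
    intro x
    have h : T.edgeInd (E i) (T.rot x).1 (base.map (T.rot x).2) =
        T.edgeInd (E i) x.1 (base.map x.2) := by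
      have h1 : T.edgeOf (x.1, Flag.corner x) = T.edgeOf ((T.rot x).1, Flag.corner (T.rot x)) :=
        Quot.sound (T.edgeStep_rot x)
      exact T.edgeInd_congr _ h1.symm
    rw [hw]
    simp only [h, T.sign_rot]
  have hface : ∀ x : Flag κ, faceSum (F (T.rot x).1) (T.rot x).2 =
      faceSum (F x.1) (x.2 * Equiv.swap 2 3) := by
    intro x
    rw [← T.faceSum_nbr _ _ (x.2 * Equiv.swap 2 3)]
    have e3 : (Equiv.swap 2 3 : Equiv.Perm (Fin 4)) 3 = 2 := by decide +kernel
    simp only [Equiv.Perm.mul_apply, e3, rot, mul_assoc, F]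
  calc _ = ∑ x : Flag κ, w x * (faceSum (F x.1) (x.2 * Equiv.swap 2 3) - faceSum (F x.1) x.2) := by
        rw [Fintype.sum_prod_type, Finset.mul_sum]
        refine Finset.sum_congr rfl fun j _ => ?_
        simp only [← sign_mul_sum_pairing, hw]
        have hs : ∀ σ : Equiv.Perm (Fin 4),
            (Equiv.Perm.sign σ : ℤ) * (Equiv.Perm.sign σ : ℤ) = 1 := by
          intro σ
          rw [← Units.val_mul, Int.units_mul_self, Units.val_one]
        have hσ : ∀ σ : Equiv.Perm (Fin 4), T.edgeInd (E i) j (base.map σ) *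
            (Equiv.Perm.sign σ : ℤ) * ((Equiv.Perm.sign σ : ℤ) *
              ∑ e, pairing (base.map σ) e * F j e) =
            (fun c => T.edgeInd (E i) j c * ∑ e, pairing c e * F j e) (base.map σ) := by
          intro σ
          rw [mul_assoc, ← mul_assoc (Equiv.Perm.sign σ : ℤ), hs, one_mul]
        simp only [hσ]
        rw [sum_map_base (fun c => T.edgeInd (E i) j c * ∑ e, pairing c e * F j e)]
        congr 1
        simp only [gluingDiff_apply, pairing, Finset.sum_mul, Finset.mul_sum,
          ← Finset.sum_sub_distrib]
        refine Finset.sum_comm.trans (Finset.sum_congr rfl fun c _ => Finset.sum_congr rfl fun e _ => ?_)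
        ring
    _ = 0 := by
        -- The weight is invariant under rotation, and rotation carries the term of one face to that
        -- of the other. The two sums therefore differ by a reindexing.
        simp only [mul_sub, Finset.sum_sub_distrib]
        rw [sub_eq_zero]
        calc _ = ∑ x : Flag κ, w (T.rotPerm x) * faceSum (F (T.rotPerm x).1) (T.rotPerm x).2 := by
              simp only [rotPerm_apply, hwrot, hface]
          _ = _ := Equiv.sum_comp T.rotPerm fun x => w x * faceSum (F x.1) x.2

variable [DecidableEq κ]

/-- The row of the completeness equation in the Neumann–Zagier matrices. -/
def cuspDiff (γ : T.PeripheralCurve) (q : Fin 3) (j : κ) : ℤ :=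
  T.cuspRow γ q j - T.cuspRow γ 1 j

theorem cuspDiff_apply (γ : T.PeripheralCurve) (q : Fin 3) (j : κ) :
    T.cuspDiff γ q j = ∑ i ∈ Finset.range γ.len,
      if (γ.flag i).1 = j then Flag.turn (γ.flag i) * kindDiff q (Flag.corner (γ.flag i)) else 0 := by
  simp only [cuspDiff, cuspRow, ← Finset.sum_sub_distrib]
  refine Finset.sum_congr rfl fun i _ => ?_
  by_cases h : (γ.flag i).1 = j
  · simp only [h, true_and, if_true, kindDiff, mul_sub, mul_ite, mul_one, mul_zero]
  · simp [h]

/-- The completeness equations are symplectically orthogonal to the edge equations. -/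
theorem gluingDiff_mulVec_cuspDiff [Fintype κ] (E : κ → T.Edge) (γ : T.PeripheralCurve) (i : κ) :
    ∑ j, T.gluingDiff E 0 i j * T.cuspDiff γ 2 j = ∑ j, T.gluingDiff E 2 i j * T.cuspDiff γ 0 j := by
  -- `u l` is the term of the face through which the `l`-th arc enters; by `hstep`, `u (l + 1)` is
  -- that of the face through which it leaves.
  set u : ℕ → ℤ := fun l =>
    faceSum (T.edgeInd (E i) (γ.flag l).1) ((γ.flag l).2 * Equiv.swap 2 3) with hu
  have hstep : ∀ l, u (l + 1) = faceSum (T.edgeInd (E i) (γ.flag l).1) (γ.flag l).2 := by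
    intro l
    rw [← T.faceSum_nbr, ← γ.next_tet]
    set g := T.glue (γ.flag l).1 ((γ.flag l).2 3) * (γ.flag l).2 with hg
    have e0 : (Equiv.swap 2 3 : Equiv.Perm (Fin 4)) 0 = 0 := by decide +kernel
    have e3 : (Equiv.swap 2 3 : Equiv.Perm (Fin 4)) 3 = 2 := by decide +kernel
    -- The gluing fixes the vertex and the entry face of the next arc but not the corner it passes;
    -- the remaining ambiguity `swap 1 2` does not change `faceSum`.
    rcases eq_one_or_swap (g⁻¹ * ((γ.flag (l + 1)).2 * Equiv.swap 2 3))
      (by rw [Equiv.Perm.mul_apply, Equiv.Perm.mul_apply, e0, γ.next_vertex, Equiv.Perm.inv_eq_iff_eq]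
          rfl)
      (by rw [Equiv.Perm.mul_apply, Equiv.Perm.mul_apply, e3, γ.next_face, Equiv.Perm.inv_eq_iff_eq]
          rfl) with h | h
    · rw [inv_mul_eq_iff_eq_mul, mul_one] at h
      rw [hu, ← h]
    · rw [inv_mul_eq_iff_eq_mul] at h
      rw [← faceSum_mul_swap _ g, ← h]
  rw [← sub_eq_zero, ← Finset.sum_sub_distrib]
  simp only [gluingDiff_apply, cuspDiff_apply]
  calc _ = ∑ l ∈ Finset.range γ.len, (u l - u (l + 1)) := by
        simp only [Finset.mul_sum, ← Finset.sum_sub_distrib]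
        rw [Finset.sum_comm]
        refine Finset.sum_congr rfl fun l _ => ?_
        rw [hstep, hu, ← sign_mul_sum_pairing]
        simp only [mul_ite, mul_zero]
        rw [Finset.sum_eq_single (γ.flag l).1]
        · simp only [if_true, Finset.mul_sum, Finset.sum_mul, ← Finset.sum_sub_distrib]
          refine Finset.sum_congr rfl fun e _ => ?_
          rw [Flag.corner_eq, pairing, Flag.turn]
          ring
        · intro j _ hj
          simp [hj.symm]
        · simp
    _ = 0 := by
        have h0 : u γ.len = u 0 := by
          have := γ.periodic 0
          rw [zero_add] at this
          simp only [hu, this]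
        rw [Finset.sum_range_sub', h0, sub_self]

end Symplectic

end Triangulation

/-! ### Heights of edges in cyclic covers -/

namespace Triangulation

open TetEdge

variable {ι : Type*} (T : Triangulation ι) (α : T.Cocycle)

section Height

/-- A function on the edges of the tetrahedra whose coboundary is the cocycle. -/
def IsHeight {T : Triangulation ι} (α : T.Cocycle) (H : ι × TetEdge → ℤ) : Prop :=
  ∀ j f e, f ∉ e.1 → H (T.nbr j f, e.map (T.glue j f)) = H (j, e) + α.c j f

theorem exists_cover_edgeOf_eq {x y : ι × TetEdge} (h : T.edgeOf x = T.edgeOf y) :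
    ∃ k : ℤ, (T.cover α ℤ).edgeOf ((x.1, k), x.2) = (T.cover α ℤ).edgeOf ((y.1, 0), y.2) := by
  rw [eq_comm, edgeOf_eq_iff] at h
  induction h with
  | refl => exact ⟨0, rfl⟩
  | @tail b c _ h ih =>
    obtain ⟨k, hk⟩ := ih
    obtain ⟨f, hf, rfl⟩ := h
    exact ⟨k + α.c b.1 f, by rw [← hk, ← (T.cover α ℤ).edgeOf_nbr (b.1, k) f b.2 hf]; rfl⟩

theorem exists_isHeight : ∃ H, IsHeight α H := by
  have hout : ∀ x : ι × TetEdge, T.edgeOf x = T.edgeOf (Quot.out (T.edgeOf x)) :=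
    fun x => (Quot.out_eq (T.edgeOf x)).symm
  choose H hH using fun x => T.exists_cover_edgeOf_eq α (hout x)
  refine ⟨H, fun j f e hf => ?_⟩
  -- The level at which a lift meets the chosen lift of its edge class is unique, by freeness; so it
  -- changes by the cocycle across a face.
  refine T.cover_edgeOf_injective α (T.nbr j f) (e.map (T.glue j f)) _ _ ?_
  rw [hH (T.nbr j f, e.map (T.glue j f)), T.edgeOf_nbr j f e hf, ← hH (j, e),
    ← (T.cover α ℤ).edgeOf_nbr (j, H (j, e)) f e hf]
  rfl

variable {T α}

theorem IsHeight.edgeOf_cover {H : ι × TetEdge → ℤ} (hH : IsHeight α H) {R : Type*} [Ring R]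
    {x y : ι × TetEdge} (h : T.edgeOf x = T.edgeOf y) (k : R) :
    (T.cover α R).edgeOf ((x.1, k + (H x : R)), x.2) =
      (T.cover α R).edgeOf ((y.1, k + (H y : R)), y.2) := by
  rw [edgeOf_eq_iff] at h
  induction h with
  | refl => rfl
  | @tail b c _ h ih =>
    obtain ⟨f, hf, rfl⟩ := h
    rw [ih, hH _ _ _ hf, ← (T.cover α R).edgeOf_nbr (b.1, k + (H b : R)) f b.2 hf, Int.cast_add,
      ← add_assoc]
    rfl

theorem IsHeight.edgeOf_eq {H : ι × TetEdge → ℤ} (hH : IsHeight α H) {R : Type*} [Ring R]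
    {x y : (ι × R) × TetEdge} (h : (T.cover α R).edgeOf x = (T.cover α R).edgeOf y) :
    T.edgeOf (x.1.1, x.2) = T.edgeOf (y.1.1, y.2) ∧
      x.1.2 - (H (x.1.1, x.2) : R) = y.1.2 - (H (y.1.1, y.2) : R) := by
  rw [edgeOf_eq_iff] at h
  induction h with
  | refl => exact ⟨rfl, rfl⟩
  | @tail b c _ h ih =>
    obtain ⟨f, hf, rfl⟩ := h
    refine ⟨ih.1.trans (T.edgeOf_nbr b.1.1 f b.2 hf).symm, ih.2.trans ?_⟩
    have := hH b.1.1 f b.2 hf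
    simp only [cover]
    rw [this, Int.cast_add]
    abel

variable (T α)

/-- Each edge of a tetrahedron of a cyclic cover belongs to exactly one translate of a chosen lift,
and the translation is independent of the cover. -/
theorem exists_height (E : T.EdgeLifts) : ∃ H : ι × TetEdge → ℤ,
    ∀ (R : Type) [Ring R] (i j : ι) (a b : R) (e : TetEdge),
      (T.cover α R).edgeOf ((j, b), e) = E.coverEdge α R (i, a) ↔
        T.edgeOf (j, e) = E.edge i ∧ b - a = (H (j, e) : R) := by
  obtain ⟨H, hH⟩ := T.exists_isHeight α
  choose idx hidx using E.bijective.2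
  -- Normalised on each edge class so that the height of the representative `E.rep i` is its
  -- prescribed level.
  refine ⟨fun x => H x - (H ((E.rep (idx (T.edgeOf x))).1.1, (E.rep (idx (T.edgeOf x))).2) -
    (E.rep (idx (T.edgeOf x))).1.2), fun R _ i j a b e => ?_⟩
  have hi : T.edgeOf (j, e) = E.edge i → idx (T.edgeOf (j, e)) = i := fun h =>
    E.bijective.1 ((hidx _).trans h)
  constructor
  · intro h
    obtain ⟨h1, h2⟩ := hH.edgeOf_eq h
    refine ⟨h1, ?_⟩
    simp only [hi h1, Int.cast_sub] at h2 ⊢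
    rw [sub_eq_iff_eq_add.1 h2]
    abel
  · rintro ⟨h1, h2⟩
    simp only [hi h1, Int.cast_sub] at h2
    have h3 := hH.edgeOf_cover (R := R) (x := (j, e)) (y := ((E.rep i).1.1, (E.rep i).2)) h1
      (b - (H (j, e) : R))
    simp only [sub_add_cancel] at h3
    rw [h3, EdgeLifts.coverEdge]
    congr 3
    rw [sub_eq_iff_eq_add.1 h2]
    abel

end Height

/-! ### Blocks of the gluing matrices of the cover -/

section Blocks

open Classical in
/-- The contribution of an edge of a tetrahedron to the Neumann–Zagier matrices. -/
noncomputable def edgeWeight {T : Triangulation ι} (E : T.EdgeLifts) (q : Fin 3) (i j : ι)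
    (e : TetEdge) : ℤ :=
  if T.edgeOf (j, e) = E.edge i then kindDiff q e else 0

variable {T α} {E : T.EdgeLifts}

theorem coverEdge_bijective (E : T.EdgeLifts) {R : Type} [Ring R] :
    Function.Bijective (E.coverEdge α R) := by
  obtain ⟨H, hH⟩ := T.exists_height α E
  refine ⟨?_, ?_⟩
  · rintro ⟨i, a⟩ ⟨i', a'⟩ h
    obtain ⟨h1, h2⟩ := (hH R i _ a _ _).1 (rfl : E.coverEdge α R (i, a) = _)
    obtain ⟨h3, h4⟩ := (hH R i' _ a' _ _).1 h
    refine Prod.ext (E.bijective.1 (h1.symm.trans h3)) ?_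
    exact sub_right_injective (h2.trans h4.symm)
  · rintro ⟨⟨j, b⟩, e⟩
    obtain ⟨i, hi⟩ := E.bijective.2 (T.edgeOf (j, e))
    exact ⟨(i, b - (H (j, e) : R)), ((hH R i j _ b e).2 ⟨hi.symm, by abel⟩).symm⟩

theorem gluingDiff_edge (q : Fin 3) (i j : ι) :
    T.gluingDiff E.edge q i j = ∑ e, edgeWeight E q i j e := by
  classical
  simp [gluingDiff_apply, edgeInd, edgeWeight]

/-- Only `b - a` enters: this is the block circulant structure, and the same weights and heights
serve `ℤ` and `ZMod n`. -/
theorem gluingDiff_cover {H : ι × TetEdge → ℤ} {R : Type} [Ring R] [DecidableEq R]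
    (hH : ∀ (i j : ι) (a b : R) (e : TetEdge),
      (T.cover α R).edgeOf ((j, b), e) = E.coverEdge α R (i, a) ↔
        T.edgeOf (j, e) = E.edge i ∧ b - a = (H (j, e) : R))
    (q : Fin 3) (i j : ι) (a b : R) :
    (T.cover α R).gluingDiff (E.coverEdge α R) q (i, a) (j, b) =
      ∑ e, if b - a = (H (j, e) : R) then edgeWeight E q i j e else 0 := by
  classical
  rw [gluingDiff_apply]
  refine Finset.sum_congr rfl fun e _ => ?_
  rw [edgeInd, edgeWeight, hH]
  by_cases h1 : T.edgeOf (j, e) = E.edge i <;> by_cases h2 : b - a = (H (j, e) : R) <;> simp [h1, h2]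

/-- Every edge of a tetrahedron lies in exactly one class, and each parameter occurs on two of the
six edges. -/
theorem sum_gluingDiff {κ : Type*} [Fintype κ] {T : Triangulation κ}
    {F : κ → T.Edge} (hF : Function.Bijective F) (q : Fin 3) (j : κ) :
    ∑ i, T.gluingDiff F q i j = 0 := by
  classical
  simp only [gluingDiff_apply]
  rw [Finset.sum_comm]
  calc _ = ∑ e, kindDiff q e := by
        refine Finset.sum_congr rfl fun e _ => ?_
        obtain ⟨i, hi, hu⟩ := hF.existsUnique (T.edgeOf (j, e))
        rw [← Finset.mul_sum, Finset.sum_eq_single i]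
        · simp [edgeInd, hi]
        · intro i' _ hne
          rw [edgeInd, if_neg fun h => hne (hu i' h.symm)]
        · simp
    _ = 0 := sum_kindDiff q

/-- The common definition of the twisted matrices `A(t)`, `B(t)`, evaluated at a unit. -/
theorem eval_finsum_gluingAt {H : ι × TetEdge → ℤ}
    (hH : ∀ (i j : ι) (a b : ℤ) (e : TetEdge),
      (T.cover α ℤ).edgeOf ((j, b), e) = E.coverEdge α ℤ (i, a) ↔
        T.edgeOf (j, e) = E.edge i ∧ b - a = H (j, e))
    (q : Fin 3) (i j : ι) (s : ℂˣ) :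
    LaurentPolynomial.eval₂ (Int.castRingHom ℂ) s (∑ᶠ k : ℤ,
      LaurentPolynomial.C (T.gluingAt α E q k i j - T.gluingAt α E 1 k i j) *
        LaurentPolynomial.T k) =
      ∑ e, (edgeWeight E q i j e : ℂ) * ((s ^ H (j, e) : ℂˣ) : ℂ) := by
  have hG : ∀ k, T.gluingAt α E q k i j - T.gluingAt α E 1 k i j =
      ∑ e, if k = H (j, e) then edgeWeight E q i j e else 0 := by
    intro k
    have := gluingDiff_cover (R := ℤ) (fun i j a b e => by simpa using hH i j a b e) q i j 0 k
    simpa [gluingDiff, gluingAt] using this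
  have hsum : (∑ᶠ k : ℤ,
      LaurentPolynomial.C (T.gluingAt α E q k i j - T.gluingAt α E 1 k i j) *
        LaurentPolynomial.T k) =
      ∑ e, LaurentPolynomial.C (edgeWeight E q i j e) * LaurentPolynomial.T (H (j, e)) := by
    -- Only the heights of the six edges of the tetrahedron can contribute.
    rw [finsum_eq_sum_of_support_subset (s := Finset.univ.image fun e => H (j, e))]
    · simp only [hG, map_sum, Finset.sum_mul]
      rw [Finset.sum_comm]
      refine Finset.sum_congr rfl fun e _ => ?_
      rw [Finset.sum_eq_single (H (j, e))]
      · simp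
      · intro k _ hk
        simp [hk]
      · intro h
        exact absurd (Finset.mem_image_of_mem _ (Finset.mem_univ e)) h
    · intro k hk
      by_contra h
      refine hk ?_
      have : ∀ e, k ≠ H (j, e) := fun e he => h (by simpa using ⟨e.1, e.2, he.symm⟩)
      simp [hG, this]
  rw [hsum, map_sum]
  simp

/-- The completeness equation of the lift of a peripheral curve projects to a multiple of the
completeness equation of the curve. -/
theorem sum_cuspDiff_lift [DecidableEq ι] (γ : T.PeripheralCurve) (n : ℕ) [NeZero n]
    (k₀ : ZMod n) (q : Fin 3)
    (j : ι) : ∑ b, (T.cover α (ZMod n)).cuspDiff (γ.lift α n k₀) q (j, b) =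
      addOrderOf (α.eval γ : ZMod n) * T.cuspDiff γ q j := by
  simp only [cuspDiff_apply]
  rw [Finset.sum_comm]
  have h := γ.sum_add_len (fun x => if x.1 = j then Flag.turn x * kindDiff q (Flag.corner x) else 0)
    (addOrderOf (α.eval γ : ZMod n)) 0
  simp only [zero_add, Finset.range_zero, Finset.sum_empty, nsmul_eq_mul] at h
  rw [← h]
  refine Finset.sum_congr rfl fun l _ => ?_
  simp only [PeripheralCurve.lift, Prod.mk.injEq]
  by_cases hj : (γ.flag l).1 = j
  · simp only [hj, true_and, if_true]
    rw [Finset.sum_ite_eq]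
    simp only [Finset.mem_univ, if_true]
    rfl
  · simp [hj]

end Blocks

end Triangulation

/-! ### Matrices with one row replaced -/

section CuspedMatrices

open Matrix

variable {κ : Type*} [Fintype κ] [DecidableEq κ] {G₁ G₂ : Matrix κ κ ℂ} {l : κ} {p₁ p₂ : κ → ℂ}

theorem updateRow_mul_updateRow_transpose_comm (hG : G₁ * G₂ᵀ = G₂ * G₁ᵀ)
    (hp : G₁ *ᵥ p₂ = G₂ *ᵥ p₁) :
    G₁.updateRow l p₁ * (G₂.updateRow l p₂)ᵀ = G₂.updateRow l p₂ * (G₁.updateRow l p₁)ᵀ := by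
  have h1 : ∀ i, ∑ j, G₁ i j * p₂ j = ∑ j, G₂ i j * p₁ j := fun i => congrFun hp i
  have h2 : ∀ i i', ∑ j, G₁ i j * G₂ i' j = ∑ j, G₂ i j * G₁ i' j := fun i i' =>
    congrFun (congrFun hG i) i'
  ext i i'
  simp only [mul_apply, transpose_apply]
  by_cases hi : i = l <;> by_cases hi' : i' = l
  · subst hi hi'
    simp only [updateRow_self]
    exact Finset.sum_congr rfl fun _ _ => mul_comm _ _
  · subst hi
    simp only [updateRow_self, updateRow_ne hi']
    simpa only [mul_comm] using (h1 i').symm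
  · subst hi'
    simpa only [updateRow_self, updateRow_ne hi] using h1 i
  · simpa only [updateRow_ne hi, updateRow_ne hi'] using h2 i i'

theorem inv_mul_transpose_eq {A B : Matrix κ κ ℂ} (hB : IsUnit B.det) (h : A * Bᵀ = B * Aᵀ) :
    (B⁻¹ * A)ᵀ = B⁻¹ * A := by
  have hBt : IsUnit Bᵀ.det := by rwa [det_transpose]
  rw [transpose_mul, transpose_nonsing_inv]
  calc Aᵀ * Bᵀ⁻¹ = B⁻¹ * (B * Aᵀ) * Bᵀ⁻¹ := by rw [nonsing_inv_mul_cancel_left _ _ hB]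
    _ = B⁻¹ * A := by rw [← h, ← Matrix.mul_assoc, mul_nonsing_inv_cancel_right _ _ hBt]

/-- Symmetry and real entries. The Hermitian form is what later lets a vanishing square force a
vanishing matrix. -/
theorem inv_mul_isHermitian {A B : Matrix κ κ ℂ} (hB : IsUnit B.det) (h : A * Bᵀ = B * Aᵀ)
    (hAr : Aᴴ = Aᵀ) (hBr : Bᴴ = Bᵀ) : (B⁻¹ * A).IsHermitian := by
  rw [IsHermitian, conjTranspose_mul, conjTranspose_nonsing_inv, hAr, hBr]
  conv_rhs => rw [← inv_mul_transpose_eq hB h]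
  rw [transpose_mul, transpose_nonsing_inv]

theorem vecMul_inv_mul_updateRow (hB : IsUnit (G₂.updateRow l p₂).det) :
    p₂ ᵥ* ((G₂.updateRow l p₂)⁻¹ * G₁.updateRow l p₁) = p₁ := by
  have h := congrFun (mul_nonsing_inv_cancel_left _ (G₁.updateRow l p₁) hB) l
  rw [mul_apply_eq_vecMul] at h
  simpa using h

/-- If the rows of two matrices sum to zero, then replacing a row of both loses no information. -/
theorem mul_inv_mul_updateRow (hB : IsUnit (G₂.updateRow l p₂).det)
    (h₁ : ∀ j, ∑ i, G₁ i j = 0) (h₂ : ∀ j, ∑ i, G₂ i j = 0) :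
    G₂ * ((G₂.updateRow l p₂)⁻¹ * G₁.updateRow l p₁) = G₁ := by
  set X := (G₂.updateRow l p₂)⁻¹ * G₁.updateRow l p₁
  have hX : G₂.updateRow l p₂ * X = G₁.updateRow l p₁ := mul_nonsing_inv_cancel_left _ _ hB
  have hne : ∀ i, i ≠ l → ∀ j, (G₂ * X) i j = G₁ i j := by
    intro i hi j
    have := congrFun (congrFun hX i) j
    simpa only [mul_apply, updateRow_ne hi] using this
  have hsum : ∀ j, ∑ i, ((G₂ * X) i j - G₁ i j) = 0 := by
    intro j
    rw [Finset.sum_sub_distrib, h₁, sub_zero]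
    simp only [mul_apply]
    rw [Finset.sum_comm]
    simp [← Finset.sum_mul, h₂]
  ext i j
  by_cases hi : i = l
  · subst hi
    have h := hsum j
    rw [Finset.sum_eq_single i (fun i' _ h' => by rw [hne i' h', sub_self]) (by simp)] at h
    exact sub_eq_zero.1 h
  · exact hne i hi j

/-- Constants lie in the left kernel of `G₂`. Subtracting `v l` makes the coordinate at `l` zero, so
the replaced row is not seen and invertibility applies. -/
theorem eq_of_vecMul_eq_zero (hB : IsUnit (G₂.updateRow l p₂).det) (h₂ : ∀ j, ∑ i, G₂ i j = 0)
    {v : κ → ℂ} (hv : v ᵥ* G₂ = 0) (i : κ) : v i = v l := by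
  have h : (fun i => v i - v l) ᵥ* G₂.updateRow l p₂ = 0 := by
    ext j
    have hj : ∑ i, v i * G₂ i j = 0 := congrFun hv j
    calc ∑ i, (v i - v l) * G₂.updateRow l p₂ i j = ∑ i, (v i - v l) * G₂ i j := by
          refine Finset.sum_congr rfl fun i _ => ?_
          by_cases hi : i = l
          · simp [hi]
          · rw [updateRow_ne hi]
      _ = 0 := by simp [sub_mul, Finset.sum_sub_distrib, hj, ← Finset.mul_sum, h₂]
  exact sub_eq_zero.1 (congrFun (eq_zero_of_vecMul_eq_zero hB.ne_zero h) i)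

open scoped ComplexOrder in
/-- A Hermitian matrix annihilated by `G₂`, whose kernel is a line, vanishes if it has trace
zero. -/
theorem eq_zero_of_mul_eq_zero_of_trace (hB : IsUnit (G₂.updateRow l p₂).det) {D : Matrix κ κ ℂ}
    (hD : D.IsHermitian) (h0 : G₂ * D = 0) (ht : D.trace = 0) : D = 0 := by
  -- Only the replaced row survives in the product, so `D` has rank at most one.
  have h1 : G₂.updateRow l p₂ * D = vecMulVec (Pi.single l 1) (p₂ ᵥ* D) := by
    ext i j
    rw [vecMulVec_apply]
    by_cases hi : i = l
    · subst hi
      rw [mul_apply_eq_vecMul, updateRow_self, Pi.single_eq_same, one_mul]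
    · rw [Pi.single_eq_of_ne hi, zero_mul]
      have := congrFun (congrFun h0 i) j
      simpa only [mul_apply, updateRow_ne hi, Matrix.zero_apply] using this
  obtain ⟨u, v, rfl⟩ : ∃ u v, D = vecMulVec u v := by
    refine ⟨(G₂.updateRow l p₂)⁻¹ *ᵥ Pi.single l 1, p₂ ᵥ* D, ?_⟩
    rw [← mul_vecMulVec, ← h1, nonsing_inv_mul_cancel_left _ _ hB]
  have h2 : v ⬝ᵥ u = 0 := by
    rw [dotProduct_comm, ← ht, trace_vecMulVec]
  have h3 : vecMulVec u v * vecMulVec u v = 0 := by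
    rw [vecMulVec_mul_vecMulVec, h2]
    simp
  rw [← conjTranspose_mul_self_eq_zero, hD.eq, h3]

/-- Symmetries of the edge equations are symmetries of `B⁻¹ A`. -/
theorem inv_mul_updateRow_submatrix (hB : IsUnit (G₂.updateRow l p₂).det)
    (h₁ : ∀ j, ∑ i, G₁ i j = 0) (h₂ : ∀ j, ∑ i, G₂ i j = 0)
    (hX : ((G₂.updateRow l p₂)⁻¹ * G₁.updateRow l p₁).IsHermitian)
    (τ : Equiv.Perm κ) (hτ₁ : G₁.submatrix τ τ = G₁) (hτ₂ : G₂.submatrix τ τ = G₂) :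
    ((G₂.updateRow l p₂)⁻¹ * G₁.updateRow l p₁).submatrix τ τ =
      (G₂.updateRow l p₂)⁻¹ * G₁.updateRow l p₁ := by
  have h := mul_inv_mul_updateRow (p₁ := p₁) hB h₁ h₂
  set X := (G₂.updateRow l p₂)⁻¹ * G₁.updateRow l p₁
  rw [← sub_eq_zero]
  refine eq_zero_of_mul_eq_zero_of_trace hB ((hX.submatrix τ).sub hX) ?_ ?_
  · rw [Matrix.mul_sub, h, sub_eq_zero]
    conv_lhs => rw [← hτ₂]
    rw [submatrix_mul_equiv, h, hτ₁]
  · rw [trace_sub, sub_eq_zero]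
    exact Equiv.sum_comp τ fun i => X i i

end CuspedMatrices

/-! ### Fourier transform of block circulant matrices -/

section Fourier

open Matrix

variable {ι : Type*} {n : ℕ} [NeZero n]

/-- The block circulant matrix with blocks `C`. -/
def blockCirculant (C : ZMod n → Matrix ι ι ℂ) : Matrix (ι × ZMod n) (ι × ZMod n) ℂ :=
  fun x y => C (y.2 - x.2) x.1 y.1

/-- The Fourier transform of a family of blocks. -/
def blockFourier (χ : AddChar (ZMod n) ℂ) (C : ZMod n → Matrix ι ι ℂ) (k : ZMod n) :
    Matrix ι ι ℂ :=
  ∑ d, χ (d * k) • C d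

/-- The block Vandermonde matrix of an additive character. -/
def charVandermonde (ι : Type*) [DecidableEq ι] (χ : AddChar (ZMod n) ℂ) :
    Matrix (ι × ZMod n) (ι × ZMod n) ℂ :=
  fun x y => if x.1 = y.1 then χ (x.2 * y.2) else 0

theorem blockFourier_apply (χ : AddChar (ZMod n) ℂ) (C : ZMod n → Matrix ι ι ℂ) (k : ZMod n)
    (i j : ι) : blockFourier χ C k i j = ∑ d, χ (d * k) * C d i j := by
  simp [blockFourier, Matrix.sum_apply]

theorem blockFourier_inv (χ : AddChar (ZMod n) ℂ) (C : ZMod n → Matrix ι ι ℂ) (k : ZMod n) :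
    blockFourier χ⁻¹ C k = blockFourier χ C (-k) := by
  simp [blockFourier, AddChar.inv_apply]

variable [Fintype ι]

/-- Summation over the sheets is the projection to frequency zero; it brings the cusp equation down
to the base. -/
theorem sum_mul_blockCirculant (χ : AddChar (ZMod n) ℂ) (C : ZMod n → Matrix ι ι ℂ)
    (p : ι × ZMod n → ℂ) (j : ι) :
    ∑ b, (p ᵥ* blockCirculant C) (j, b) = ∑ i, (∑ a, p (i, a)) * blockFourier χ C 0 i j := by
  simp only [vecMul, dotProduct, Fintype.sum_prod_type, blockCirculant, blockFourier_apply, mul_zero,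
    AddChar.map_zero_eq_one, one_mul]
  rw [Finset.sum_comm]
  refine Finset.sum_congr rfl fun i _ => ?_
  rw [Finset.sum_comm, Finset.sum_mul]
  refine Finset.sum_congr rfl fun a _ => ?_
  rw [← Finset.mul_sum]
  congr 1
  exact Equiv.sum_comp (Equiv.subRight a) fun d => C d i j

variable [DecidableEq ι]

theorem blockCirculant_mul_charVandermonde (χ : AddChar (ZMod n) ℂ) (C : ZMod n → Matrix ι ι ℂ) :
    blockCirculant C * charVandermonde ι χ =
      charVandermonde ι χ * blockDiagonal (blockFourier χ C) := by
  ext ⟨i, a⟩ ⟨j, b⟩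
  simp only [mul_apply, Fintype.sum_prod_type, charVandermonde, blockCirculant,
    blockDiagonal_apply, ite_mul, mul_ite, mul_zero, zero_mul]
  rw [Finset.sum_comm]
  simp only [Finset.sum_ite_eq, Finset.sum_ite_eq', Finset.mem_univ, if_true, blockFourier_apply]
  rw [Finset.mul_sum, ← Equiv.sum_comp (Equiv.addRight a)]
  refine Finset.sum_congr rfl fun d _ => ?_
  simp only [Equiv.coe_addRight, add_sub_cancel_right, add_mul, AddChar.map_add_eq_mul]
  ring

theorem charVandermonde_mul_inv {χ : AddChar (ZMod n) ℂ} (hχ : χ.IsPrimitive) :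
    charVandermonde ι χ * charVandermonde ι χ⁻¹ = (n : ℂ) • 1 := by
  ext ⟨i, a⟩ ⟨j, b⟩
  have h : ∀ c : ZMod n, χ (a * c) * χ (-(c * b)) = χ (c * (a - b)) := by
    intro c
    rw [← AddChar.map_add_eq_mul]
    congr 1
    ring
  have hs : (charVandermonde ι χ * charVandermonde ι χ⁻¹) (i, a) (j, b) =
      if i = j then ∑ c : ZMod n, χ (c * (a - b)) else 0 := by
    simp only [mul_apply, Fintype.sum_prod_type, charVandermonde, AddChar.inv_apply, ite_mul,
      mul_ite, mul_zero, zero_mul, h]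
    rw [Finset.sum_eq_single i]
    · simp
    · intro m _ hm
      simp [hm.symm]
    · simp
  rw [hs, AddChar.sum_mulShift _ hχ, ZMod.card]
  by_cases hij : i = j <;> by_cases hab : a = b <;> simp [hij, hab, one_apply, sub_eq_zero]

theorem charVandermonde_inv {χ : AddChar (ZMod n) ℂ} (hχ : χ.IsPrimitive) :
    (charVandermonde ι χ)⁻¹ = (n : ℂ)⁻¹ • charVandermonde ι χ⁻¹ := by
  refine inv_eq_right_inv ?_
  rw [Matrix.mul_smul, charVandermonde_mul_inv hχ, smul_smul,
    inv_mul_cancel₀ (Nat.cast_ne_zero.2 (NeZero.ne n)), one_smul]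

theorem isUnit_det_charVandermonde {χ : AddChar (ZMod n) ℂ} (hχ : χ.IsPrimitive) :
    IsUnit (charVandermonde ι χ).det := by
  refine isUnit_det_of_right_inverse (B := (n : ℂ)⁻¹ • charVandermonde ι χ⁻¹) ?_
  rw [Matrix.mul_smul, charVandermonde_mul_inv hχ, smul_smul,
    inv_mul_cancel₀ (Nat.cast_ne_zero.2 (NeZero.ne n)), one_smul]

theorem inv_mul_blockCirculant_mul {χ : AddChar (ZMod n) ℂ} (hχ : χ.IsPrimitive)
    (C : ZMod n → Matrix ι ι ℂ) :
    (charVandermonde ι χ)⁻¹ * blockCirculant C * charVandermonde ι χ =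
      blockDiagonal (blockFourier χ C) := by
  rw [Matrix.mul_assoc, blockCirculant_mul_charVandermonde,
    nonsing_inv_mul_cancel_left _ _ (isUnit_det_charVandermonde hχ)]

theorem mul_blockCirculant_mul_inv {χ : AddChar (ZMod n) ℂ} (hχ : χ.IsPrimitive)
    (C : ZMod n → Matrix ι ι ℂ) :
    charVandermonde ι χ * blockCirculant C * (charVandermonde ι χ)⁻¹ =
      blockDiagonal fun k => blockFourier χ C (-k) := by
  -- Up to the factor `n`, the inverse of the Vandermonde matrix is that of `χ⁻¹`, which reverses
  -- the frequencies.
  have h := blockCirculant_mul_charVandermonde χ⁻¹ C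
  simp only [funext (blockFourier_inv χ C)] at h
  rw [Matrix.mul_assoc, charVandermonde_inv hχ, Matrix.mul_smul, h, ← Matrix.smul_mul, ← charVandermonde_inv hχ,
    mul_nonsing_inv_cancel_left _ _ (isUnit_det_charVandermonde hχ)]

theorem blockFourier_mul {χ : AddChar (ZMod n) ℂ} (hχ : χ.IsPrimitive)
    {C D F : ZMod n → Matrix ι ι ℂ} (h : blockCirculant C * blockCirculant D = blockCirculant F)
    (k : ZMod n) : blockFourier χ C k * blockFourier χ D k = blockFourier χ F k := by
  have hV := isUnit_det_charVandermonde (ι := ι) hχ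
  have h1 : blockDiagonal (fun k => blockFourier χ C k * blockFourier χ D k) =
      blockDiagonal (blockFourier χ F) := by
    rw [blockDiagonal_mul, ← inv_mul_blockCirculant_mul hχ F, ← h, Matrix.mul_assoc,
      Matrix.mul_assoc, blockCirculant_mul_charVandermonde, ← Matrix.mul_assoc (blockCirculant C),
      blockCirculant_mul_charVandermonde, Matrix.mul_assoc, nonsing_inv_mul_cancel_left _ _ hV]
  exact congrFun (blockDiagonal_injective h1) k

end Fourier

/-! ### Fourier transform in the presence of a cusp row -/

section CuspedBlocks

open Matrix

variable {ι : Type*} {n : ℕ}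

theorem blockCirculant_of_shift {X : Matrix (ι × ZMod n) (ι × ZMod n) ℂ}
    (h : ∀ c : ZMod n, X.submatrix ((Equiv.refl ι).prodCongr (Equiv.addRight c))
      ((Equiv.refl ι).prodCongr (Equiv.addRight c)) = X) :
    X = blockCirculant fun d i j => X (i, 0) (j, d) := by
  ext ⟨i, a⟩ ⟨j, b⟩
  have := congrFun (congrFun (h (-a)) (i, a)) (j, b)
  simpa [blockCirculant, ← sub_eq_add_neg] using this.symm

theorem blockCirculant_shift (C : ZMod n → Matrix ι ι ℂ) (c : ZMod n) :
    (blockCirculant C).submatrix ((Equiv.refl ι).prodCongr (Equiv.addRight c))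
      ((Equiv.refl ι).prodCongr (Equiv.addRight c)) = blockCirculant C := by
  ext ⟨i, a⟩ ⟨j, b⟩
  simp [blockCirculant]

variable [NeZero n] [Fintype ι]

theorem blockCirculant_mulVec (χ : AddChar (ZMod n) ℂ) (C : ZMod n → Matrix ι ι ℂ) (w : ι → ℂ)
    (i : ι) (a : ZMod n) :
    (blockCirculant C *ᵥ fun x => w x.1) (i, a) = (blockFourier χ C 0 *ᵥ w) i := by
  simp only [mulVec, dotProduct, Fintype.sum_prod_type, blockCirculant, blockFourier_apply,
    mul_zero, AddChar.map_zero_eq_one, one_mul]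
  refine Finset.sum_congr rfl fun j _ => ?_
  rw [← Finset.sum_mul]
  congr 1
  exact Equiv.sum_comp (Equiv.subRight a) fun d => C d i j

theorem vecMul_blockCirculant (χ : AddChar (ZMod n) ℂ) (C : ZMod n → Matrix ι ι ℂ) (v : ι → ℂ)
    (k : ZMod n) (j : ι) (b : ZMod n) :
    ((fun x : ι × ZMod n => v x.1 * χ (-(x.2 * k))) ᵥ* blockCirculant C) (j, b) =
      χ (-(b * k)) * (v ᵥ* blockFourier χ C k) j := by
  simp only [vecMul, dotProduct, Fintype.sum_prod_type, blockCirculant, blockFourier_apply,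
    Finset.mul_sum]
  refine Finset.sum_congr rfl fun i _ => ?_
  rw [← Equiv.sum_comp (Equiv.subLeft b)]
  refine Finset.sum_congr rfl fun d _ => ?_
  have h : -((b - d) * k) = -(b * k) + d * k := by ring
  simp only [Equiv.subLeft_apply, sub_sub_cancel, h, AddChar.map_add_eq_mul]
  ring

theorem sum_blockFourier_zero (χ : AddChar (ZMod n) ℂ) {C : ZMod n → Matrix ι ι ℂ}
    (h : ∀ y, ∑ x, blockCirculant C x y = 0) (j : ι) : ∑ i, blockFourier χ C 0 i j = 0 := by
  have h1 := sum_mul_blockCirculant χ C 1 j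
  have h2 : (1 : ι × ZMod n → ℂ) ᵥ* blockCirculant C = 0 := by
    ext y
    simpa [vecMul, dotProduct] using h y
  simp only [h2, Pi.zero_apply, Finset.sum_const_zero, Pi.one_apply, Finset.sum_const,
    Finset.card_univ, ZMod.card, nsmul_eq_mul, mul_one, ← Finset.mul_sum] at h1
  exact (mul_eq_zero.1 h1.symm).resolve_left (Nat.cast_ne_zero.2 (NeZero.ne n))

variable [DecidableEq ι]

variable {χ : AddChar (ZMod n) ℂ} {C₁ C₂ : ZMod n → Matrix ι ι ℂ} {last : ι} {l : ι × ZMod n}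
  {p₁ p₂ : ι × ZMod n → ℂ} {r₁ r₂ : ι → ℂ} {d : ℂ}

/-- A left null vector at frequency `k`, twisted by the character over the sheets, lies in the left
kernel of the circulant matrix and so is constant; a nontrivial character allows only zero. -/
theorem isUnit_det_blockFourier (hχ : χ.IsPrimitive)
    (hB : IsUnit ((blockCirculant C₂).updateRow l p₂).det)
    (h₂ : ∀ y, ∑ x, blockCirculant C₂ x y = 0) {k : ZMod n} (hk : k ≠ 0) :
    IsUnit (blockFourier χ C₂ k).det := by
  rw [isUnit_iff_ne_zero]
  intro h
  obtain ⟨v, hv, hv0⟩ := exists_vecMul_eq_zero_iff.2 h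
  refine hv (funext fun i => ?_)
  have h1 := eq_of_vecMul_eq_zero hB h₂ (v := fun x : ι × ZMod n => v x.1 * χ (-(x.2 * k))) (by
    ext ⟨j, b⟩
    rw [vecMul_blockCirculant, hv0]
    simp)
  obtain ⟨a, ha⟩ := (AddChar.ne_one_iff).1 (hχ hk)
  have h2 := (h1 (i, -a)).trans (h1 (i, 0)).symm
  simp only [neg_mul, neg_neg, zero_mul, neg_zero, AddChar.map_zero_eq_one, mul_one] at h2
  rw [AddChar.mulShift_apply, mul_comm] at ha
  by_contra hi
  exact ha (mul_left_cancel₀ hi (h2.trans (mul_one _).symm))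

/-- A right null vector, repeated in every sheet, is a null vector of the matrix of the cover. The
edge equation missing in row `last` follows from the zero column sums. -/
theorem isUnit_det_blockFourier_zero_updateRow (χ : AddChar (ZMod n) ℂ) (hl : l.1 = last)
    (hB : IsUnit ((blockCirculant C₂).updateRow l p₂).det)
    (h₂ : ∀ y, ∑ x, blockCirculant C₂ x y = 0) (hp : ∀ j, ∑ b, p₂ (j, b) = d * r₂ j) :
    IsUnit ((blockFourier χ C₂ 0).updateRow last r₂).det := by
  rw [isUnit_iff_ne_zero]
  intro h
  obtain ⟨w, hw, hw0⟩ := exists_mulVec_eq_zero_iff.2 h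
  have hr : ∑ j, r₂ j * w j = 0 := by
    have := congrFun hw0 last
    simpa only [mulVec, updateRow_self, dotProduct, Pi.zero_apply] using this
  have hne : ∀ i, i ≠ last → (blockFourier χ C₂ 0 *ᵥ w) i = 0 := by
    intro i hi
    have := congrFun hw0 i
    simpa only [mulVec, updateRow_ne hi, Pi.zero_apply] using this
  have hall : ∀ i, (blockFourier χ C₂ 0 *ᵥ w) i = 0 := by
    intro i
    by_cases hi : i = last
    · subst hi
      have hs : ∑ i, (blockFourier χ C₂ 0 *ᵥ w) i = 0 := by
        simp only [mulVec, dotProduct]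
        rw [Finset.sum_comm]
        simp [← Finset.sum_mul, sum_blockFourier_zero χ h₂]
      rwa [Finset.sum_eq_single i (fun i' _ h' => hne i' h') (by simp)] at hs
    · exact hne i hi
  have h0 : (blockCirculant C₂).updateRow l p₂ *ᵥ (fun x => w x.1) = 0 := by
    ext x
    by_cases hx : x = l
    · subst hx
      simp only [mulVec, updateRow_self, dotProduct, Fintype.sum_prod_type, ← Finset.sum_mul, hp,
        mul_assoc, ← Finset.mul_sum, hr, mul_zero, Pi.zero_apply]
    · have := (blockCirculant_mulVec χ C₂ w x.1 x.2).trans (hall x.1)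
      simpa only [mulVec, updateRow_ne hx, Pi.zero_apply] using this
  exact hw (funext fun j => congrFun (eq_zero_of_mulVec_eq_zero hB.ne_zero h0) (j, 0))

/-- The Fourier transform of `B⁻¹ A` for two block circulant matrices, each with one row replaced. -/
theorem exists_blockCirculant_inv_mul (hχ : χ.IsPrimitive) (hl : l.1 = last) (hd : d ≠ 0)
    (hp₁ : ∀ j, ∑ b, p₁ (j, b) = d * r₁ j) (hp₂ : ∀ j, ∑ b, p₂ (j, b) = d * r₂ j)
    (h₁ : ∀ y, ∑ x, blockCirculant C₁ x y = 0) (h₂ : ∀ y, ∑ x, blockCirculant C₂ x y = 0)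
    (hG : blockCirculant C₁ * (blockCirculant C₂)ᵀ = blockCirculant C₂ * (blockCirculant C₁)ᵀ)
    (hGp : blockCirculant C₁ *ᵥ p₂ = blockCirculant C₂ *ᵥ p₁)
    (hr₁ : ((blockCirculant C₁).updateRow l p₁)ᴴ = ((blockCirculant C₁).updateRow l p₁)ᵀ)
    (hr₂ : ((blockCirculant C₂).updateRow l p₂)ᴴ = ((blockCirculant C₂).updateRow l p₂)ᵀ)
    (hB : IsUnit ((blockCirculant C₂).updateRow l p₂).det) :
    ∃ C : ZMod n → Matrix ι ι ℂ,
      ((blockCirculant C₂).updateRow l p₂)⁻¹ * (blockCirculant C₁).updateRow l p₁ =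
        blockCirculant C ∧
      (∀ k, k ≠ 0 → blockFourier χ C₂ k * blockFourier χ C k = blockFourier χ C₁ k) ∧
      (blockFourier χ C₂ 0).updateRow last r₂ * blockFourier χ C 0 =
        (blockFourier χ C₁ 0).updateRow last r₁ := by
  have hX := inv_mul_isHermitian hB (updateRow_mul_updateRow_transpose_comm (l := l) hG hGp) hr₁ hr₂
  have hC := blockCirculant_of_shift fun c => inv_mul_updateRow_submatrix hB h₁ h₂ hX _
    (blockCirculant_shift C₁ c) (blockCirculant_shift C₂ c)
  have hmul := mul_inv_mul_updateRow (p₁ := p₁) hB h₁ h₂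
  have hvec := vecMul_inv_mul_updateRow (G₁ := blockCirculant C₁) (p₁ := p₁) hB
  refine ⟨_, hC, ?_⟩
  rw [hC] at hmul hvec
  set C := fun d i j => (((blockCirculant C₂).updateRow l p₂)⁻¹ *
    (blockCirculant C₁).updateRow l p₁) (i, 0) (j, d)
  have hF := blockFourier_mul hχ hmul
  refine ⟨fun k _ => hF k, ?_⟩
  ext i j
  by_cases hi : i = last
  · subst hi
    -- The replaced row says `p₂ ᵥ* X = p₁`; its sum over the sheets is `d` times the cusp equation
    -- of the base.
    have h := sum_mul_blockCirculant χ C p₂ j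
    simp only [hvec, hp₁, hp₂, mul_assoc, ← Finset.mul_sum] at h
    simpa only [mul_apply, updateRow_self] using (mul_left_cancel₀ hd h).symm
  · have h := congrFun (congrFun (hF 0) i) j
    simpa only [mul_apply, updateRow_ne hi] using h

end CuspedBlocks

/-! ### Inverses and formal power series -/

section Inverse

open Matrix

variable {κ : Type*} [Fintype κ] [DecidableEq κ]

theorem map_inv_of_isUnit_det {R S : Type*} [CommRing R] [CommRing S] (f : R →+* S)
    {M : Matrix κ κ R} (hM : IsUnit M.det) : (M.map f)⁻¹ = M⁻¹.map f := by
  refine inv_eq_right_inv ?_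
  rw [← Matrix.map_mul, mul_nonsing_inv _ hM, Matrix.map_one _ f.map_zero f.map_one]

variable {ι o : Type*} [Fintype ι] [DecidableEq ι] [Fintype o] [DecidableEq o]

theorem inv_blockDiagonal_of_isUnit_det {M : o → Matrix ι ι ℂ} (hM : ∀ k, IsUnit (M k).det) :
    (blockDiagonal M)⁻¹ = blockDiagonal fun k => (M k)⁻¹ := by
  refine inv_eq_right_inv ?_
  rw [← blockDiagonal_mul, ← blockDiagonal_one]
  exact congrArg _ (funext fun k => mul_nonsing_inv _ (hM k))

/-- With `U` and `W` kept apart, the statement covers conjugation by V in both directions. -/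
theorem conj_smul_inv_map_eq_blockDiagonal {U W Y : Matrix (ι × o) (ι × o) ℂ}
    {M : o → Matrix ι ι ℂ} (hU : IsUnit U.det) (hW : U⁻¹ = W) (hM : ∀ k, IsUnit (M k).det)
    (h : W * Y * U = blockDiagonal M) :
    W.map (PowerSeries.C (R := ℂ)) * ((PowerSeries.X : PowerSeries ℂ) • Y⁻¹.map PowerSeries.C) *
        U.map (PowerSeries.C (R := ℂ)) =
      blockDiagonal fun k => (PowerSeries.X : PowerSeries ℂ) • (M k)⁻¹.map PowerSeries.C := by
  have hWY : W * Y⁻¹ * U = blockDiagonal fun k => (M k)⁻¹ := by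
    rw [← inv_blockDiagonal_of_isUnit_det hM, ← h, Matrix.mul_inv_rev, Matrix.mul_inv_rev, ← hW,
      nonsing_inv_nonsing_inv _ hU, Matrix.mul_assoc]
  rw [Matrix.mul_smul, Matrix.smul_mul, ← Matrix.map_mul, ← Matrix.map_mul, hWY,
    blockDiagonal_map _ _ (map_zero _), ← blockDiagonal_smul]
  rfl

end Inverse

/-! ### Roots of unity and the main theorem -/

namespace Triangulation

open Matrix TetEdge

/-- The character `k ↦ ω ^ k` of `ZMod n`. -/
noncomputable def rootChar (n : ℕ) [NeZero n] : AddChar (ZMod n) ℂ :=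
  AddChar.zmodChar n
    ((IsPrimitiveRoot.iff_def _ n).1 (Complex.isPrimitiveRoot_exp n (NeZero.ne n))).1

theorem rootChar_isPrimitive (n : ℕ) [NeZero n] : (rootChar n).IsPrimitive :=
  AddChar.zmodChar_primitive_of_primitive_root n (Complex.isPrimitiveRoot_exp n (NeZero.ne n))

theorem rootOmega_pow_val (n : ℕ) [NeZero n] (k : ZMod n) :
    (rootOmega n : ℂ) ^ k.val = rootChar n k := by
  rw [rootChar, AddChar.zmodChar_apply]
  rfl

theorem rootOmega_pow_val_zpow (n : ℕ) [NeZero n] (k : ZMod n) (h : ℤ) :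
    (((rootOmega n ^ k.val) ^ h : ℂˣ) : ℂ) = rootChar n (h * k) := by
  rw [← zsmul_eq_mul, AddChar.map_zsmul_eq_zpow, Units.val_zpow_eq_zpow_val, Units.val_pow_eq_pow_val,
    rootOmega_pow_val]

theorem blockVandermonde_eq (ι : Type*) [DecidableEq ι] (n : ℕ) [NeZero n] :
    blockVandermonde ι n = charVandermonde ι (rootChar n) := by
  ext x y
  simp only [blockVandermonde, charVandermonde]
  congr 1
  have h : x.2 * y.2 = ((x.2.val * y.2.val : ℕ) : ZMod n) := by simp
  rw [h, rootChar, AddChar.zmodChar_apply']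
  rfl

section Real

variable {κ : Type*}

theorem map_intCast_conjTranspose (M : Matrix κ κ ℤ) :
    (M.map (Int.castRingHom ℂ))ᴴ = (M.map (Int.castRingHom ℂ))ᵀ := by
  ext i j
  simp

theorem map_updateRow_intCast [DecidableEq κ] (M : Matrix κ κ ℤ) (l : κ) (p : κ → ℤ) :
    (M.updateRow l p).map (Int.castRingHom ℂ) =
      (M.map (Int.castRingHom ℂ)).updateRow l fun j => (p j : ℂ) := by
  ext i j
  by_cases h : i = l
  · subst h
    simp
  · simp [updateRow_ne h]

variable [DecidableEq κ] (T : Triangulation κ) (F : κ → T.Edge) (l : κ) (γ : T.PeripheralCurve)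

theorem gluingCusp_sub (q : Fin 3) : T.gluingCusp F l γ q - T.gluingCusp F l γ 1 =
    (T.gluingDiff F q).updateRow l (T.cuspDiff γ q) := by
  ext i j
  by_cases h : i = l
  · subst h
    simp [gluingCusp, cuspDiff]
  · simp [gluingCusp, gluingDiff, updateRow_ne h]

end Real

variable {ι : Type*} {T : Triangulation ι} {α : T.Cocycle}

/-- The blocks of the Neumann–Zagier matrices of the `n`-cyclic cover, without a cusp equation. -/
noncomputable def edgeBlocks (E : T.EdgeLifts) (H : ι × TetEdge → ℤ) (n : ℕ) (q : Fin 3) :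
    ZMod n → Matrix ι ι ℂ :=
  fun d i j => ∑ e, if d = (H (j, e) : ZMod n) then (edgeWeight E q i j e : ℂ) else 0

theorem blockFourier_edgeBlocks (E : T.EdgeLifts) (H : ι × TetEdge → ℤ) {n : ℕ} [NeZero n]
    (χ : AddChar (ZMod n) ℂ) (q : Fin 3) (k : ZMod n) (i j : ι) :
    blockFourier χ (edgeBlocks E H n q) k i j =
      ∑ e, (edgeWeight E q i j e : ℂ) * χ (H (j, e) * k) := by
  simp only [blockFourier_apply, edgeBlocks, Finset.mul_sum]
  rw [Finset.sum_comm]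
  refine Finset.sum_congr rfl fun e _ => ?_
  simp [mul_comm]

end Triangulation

-- The residue `-1` is the block `n - 1`, so `(last, -1)` is the last row when `last` is the last
-- position. Since `ω ^ n = 1`, the index `-k` gives the value at `ω ^ (-k)`.
open Matrix Triangulation in
theorem theorem3p1 {ι : Type*} [Fintype ι] [DecidableEq ι]
    (T : Triangulation ι) (hT : T.OneCusped) (α : T.Cocycle) (E : T.EdgeLifts) (last : ι)
    (mer lon : T.PeripheralCurve) (hmer : α.eval mer = 1) (hlon : α.eval lon = 0)
    (z : ι → ℂ) (hz : ∀ j, z j ≠ 0 ∧ z j ≠ 1)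
    (n : ℕ) [NeZero n] (hn : 2 ≤ n)
    (γ : T.PeripheralCurve) (hγ : γ = mer ∨ γ = lon) (k₀ : ZMod n)
    (An Bn : Matrix (ι × ZMod n) (ι × ZMod n) ℂ)
    (hAn : An = (T.cover α (ZMod n)).nzA (E.coverEdge α (ZMod n)) (last, -1) (γ.lift α n k₀))
    (hBn : Bn = (T.cover α (ZMod n)).nzB (E.coverEdge α (ZMod n)) (last, -1) (γ.lift α n k₀))
    (A B : ZMod n → Matrix ι ι ℂ)
    (hA : ∀ k, A k = if k = 0 then T.nzA E.edge last γ
      else Triangulation.evalAt (T.twistedA α E) (rootOmega n ^ k.val))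
    (hB : ∀ k, B k = if k = 0 then T.nzB E.edge last γ
      else Triangulation.evalAt (T.twistedB α E) (rootOmega n ^ k.val))
    (V : Matrix (ι × ZMod n) (ι × ZMod n) ℂ) (hV : V = blockVandermonde ι n)
    (hinv : IsUnit Bn.det) :
    IsUnit V.det ∧ (∀ k, IsUnit (B k).det) ∧
    IsBlockCirculant (Bn⁻¹ * An) ∧
    V⁻¹ * (Bn⁻¹ * An) * V = Matrix.blockDiagonal (fun k => (B k)⁻¹ * A k) ∧
    V * (Bn⁻¹ * An) * V⁻¹ = Matrix.blockDiagonal (fun k => (B (-k))⁻¹ * A (-k)) ∧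
    (IsUnit (-(Bn⁻¹ * An) + Matrix.diagonal fun x : ι × ZMod n => 1 / (1 - z x.1)).det →
      (∀ k, IsUnit (-((B k)⁻¹ * A k) + Matrix.diagonal fun j => 1 / (1 - z j)).det) ∧
      (V.map (PowerSeries.C (R := ℂ)))⁻¹ * propagator An Bn (fun x => z x.1) *
          V.map (PowerSeries.C (R := ℂ)) =
        Matrix.blockDiagonal (fun k => propagator (A k) (B k) z) ∧
      V.map (PowerSeries.C (R := ℂ)) * propagator An Bn (fun x => z x.1) *
          (V.map (PowerSeries.C (R := ℂ)))⁻¹ =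
        Matrix.blockDiagonal (fun k => propagator (A (-k)) (B (-k)) z)) := by
  obtain ⟨H, hH⟩ := T.exists_height α E
  set χ := rootChar n with hχdef
  have hχ : χ.IsPrimitive := rootChar_isPrimitive n
  set G : Fin 3 → Matrix (ι × ZMod n) (ι × ZMod n) ℤ :=
    (T.cover α (ZMod n)).gluingDiff (E.coverEdge α (ZMod n)) with hG
  set p : Fin 3 → ι × ZMod n → ℤ := (T.cover α (ZMod n)).cuspDiff (γ.lift α n k₀) with hp
  set C : Fin 3 → ZMod n → Matrix ι ι ℂ := edgeBlocks E H n with hC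
  have hGC : ∀ q, (G q).map (Int.castRingHom ℂ) = blockCirculant (C q) := by
    intro q
    ext ⟨i, a⟩ ⟨j, b⟩
    rw [map_apply, hG, gluingDiff_cover (hH (ZMod n))]
    simp [blockCirculant, hC, edgeBlocks]
  have hupd : ∀ q, ((G q).updateRow (last, -1) (p q)).map (Int.castRingHom ℂ) =
      (blockCirculant (C q)).updateRow (last, -1) fun x => (p q x : ℂ) := by
    intro q
    rw [map_updateRow_intCast, hGC]
  have hsum : ∀ q y, ∑ x, blockCirculant (C q) x y = 0 := by
    intro q y
    have h := sum_gluingDiff (coverEdge_bijective (α := α) (R := ZMod n) E) q y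
    simp only [← hGC, map_apply, eq_intCast]
    exact_mod_cast h
  have hsymm : blockCirculant (C 0) * (blockCirculant (C 2))ᵀ =
      blockCirculant (C 2) * (blockCirculant (C 0))ᵀ := by
    have h := congrArg (fun M => M.map (Int.castRingHom ℂ))
      ((T.cover α (ZMod n)).gluingDiff_mul_transpose (E.coverEdge α (ZMod n)))
    simpa only [Matrix.map_mul, ← transpose_map, ← hGC] using h
  have hcusp : blockCirculant (C 0) *ᵥ (fun x => (p 2 x : ℂ)) =
      blockCirculant (C 2) *ᵥ fun x => (p 0 x : ℂ) := by
    ext i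
    have h := (T.cover α (ZMod n)).gluingDiff_mulVec_cuspDiff (E.coverEdge α (ZMod n))
      (γ.lift α n k₀) i
    simp only [← hGC, mulVec, dotProduct, map_apply, eq_intCast]
    exact_mod_cast h
  have hproj : ∀ q j, ∑ b, (p q (j, b) : ℂ) =
      (addOrderOf (α.eval γ : ZMod n) : ℂ) * (T.cuspDiff γ q j : ℂ) := by
    intro q j
    exact_mod_cast sum_cuspDiff_lift γ n k₀ q j
  have hAn' : An = (blockCirculant (C 0)).updateRow (last, -1) fun x => (p 0 x : ℂ) := by
    rw [hAn, nzA, gluingCusp_sub, hupd]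
  have hBn' : Bn = (blockCirculant (C 2)).updateRow (last, -1) fun x => (p 2 x : ℂ) := by
    rw [hBn, nzB, gluingCusp_sub, hupd]
  have hzero : ∀ q, (T.gluingDiff E.edge q).map (Int.castRingHom ℂ) = blockFourier χ (C q) 0 := by
    intro q
    ext i j
    rw [map_apply, gluingDiff_edge, hC, blockFourier_edgeBlocks]
    simp
  -- Evaluating at `ω ^ k` weights an edge of height `h` by `ω ^ (h k)`, which is the character used
  -- in the Fourier transform.
  have htw : ∀ q i j k, LaurentPolynomial.eval₂ (Int.castRingHom ℂ) (rootOmega n ^ k.val)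
      (∑ᶠ m : ℤ, LaurentPolynomial.C (T.gluingAt α E q m i j - T.gluingAt α E 1 m i j) *
        LaurentPolynomial.T m) = blockFourier χ (C q) k i j := by
    intro q i j k
    rw [eval_finsum_gluingAt (fun i j a b e => by simpa using hH ℤ i j a b e), hC,
      blockFourier_edgeBlocks]
    simp only [rootOmega_pow_val_zpow, hχdef]
  have hA' : ∀ k, A k = if k = 0 then
      (blockFourier χ (C 0) 0).updateRow last (fun j => (T.cuspDiff γ 0 j : ℂ))
      else blockFourier χ (C 0) k := by
    intro k
    rw [hA, nzA, gluingCusp_sub, map_updateRow_intCast, hzero]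
    congr 1
    ext i j
    exact htw 0 i j k
  have hB' : ∀ k, B k = if k = 0 then
      (blockFourier χ (C 2) 0).updateRow last (fun j => (T.cuspDiff γ 2 j : ℂ))
      else blockFourier χ (C 2) k := by
    intro k
    rw [hB, nzB, gluingCusp_sub, map_updateRow_intCast, hzero]
    congr 1
    ext i j
    exact htw 2 i j k
  rw [hBn'] at hinv
  have hBunit : ∀ k, IsUnit (B k).det := by
    intro k
    rw [hB']
    split_ifs with hk
    · exact isUnit_det_blockFourier_zero_updateRow χ rfl hinv (hsum 2) (hproj 2)
    · exact isUnit_det_blockFourier hχ hinv (hsum 2) hk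
  obtain ⟨X, hX, hXk, hX0⟩ := exists_blockCirculant_inv_mul (last := last) hχ rfl
    (Nat.cast_ne_zero.2 (addOrderOf_pos (α.eval γ : ZMod n)).ne') (hproj 0) (hproj 2) (hsum 0)
    (hsum 2) hsymm hcusp (by rw [← hupd, map_intCast_conjTranspose])
    (by rw [← hupd, map_intCast_conjTranspose]) hinv
  rw [← hBn', ← hAn'] at hX
  have hXF : ∀ k, blockFourier χ X k = (B k)⁻¹ * A k := by
    intro k
    have h : B k * blockFourier χ X k = A k := by
      rw [hA', hB']
      split_ifs with hk
      · rw [hk, hX0]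
      · exact hXk k hk
    rw [← h, nonsing_inv_mul_cancel_left _ _ (hBunit k)]
  have hVunit := isUnit_det_charVandermonde (ι := ι) hχ
  rw [blockVandermonde_eq, ← hχdef] at hV
  rw [← hV] at hVunit
  have hconj : ∀ Y : ZMod n → Matrix ι ι ℂ,
      V⁻¹ * blockCirculant Y * V = blockDiagonal (blockFourier χ Y) := by
    intro Y
    rw [hV, inv_mul_blockCirculant_mul hχ]
  have hconj' : ∀ Y : ZMod n → Matrix ι ι ℂ,
      V * blockCirculant Y * V⁻¹ = blockDiagonal fun k => blockFourier χ Y (-k) := by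
    intro Y
    rw [hV, mul_blockCirculant_mul_inv hχ]
  refine ⟨hVunit, hBunit, ⟨X, fun i a j b => by rw [hX]; rfl⟩, ?_, ?_, fun hY => ?_⟩
  · rw [hX, hconj, funext hXF]
  · rw [hX, hconj']
    simp only [hXF]
  set D : Matrix ι ι ℂ := diagonal fun j => 1 / (1 - z j) with hD
  -- The shapes are the same in all sheets, so the diagonal term is block circulant, concentrated in
  -- block `0`, and contributes `D` at every frequency.
  set Y : ZMod n → Matrix ι ι ℂ := fun d => -X d + if d = 0 then D else 0 with hYdef
  have hYX : -(Bn⁻¹ * An) + diagonal (fun x : ι × ZMod n => 1 / (1 - z x.1)) =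
      blockCirculant Y := by
    rw [hX]
    ext ⟨i, a⟩ ⟨j, b⟩
    by_cases hab : a = b
    · subst hab
      simp [blockCirculant, hYdef, hD, diagonal_apply]
    · have hba : b - a ≠ 0 := fun h => hab (sub_eq_zero.1 h).symm
      simp [blockCirculant, hYdef, hab, hba]
  have hYF : ∀ k, blockFourier χ Y k = -((B k)⁻¹ * A k) + D := by
    intro k
    rw [← hXF]
    simp [blockFourier, hYdef, smul_add, Finset.sum_add_distrib]
  have hYunit : ∀ k, IsUnit (blockFourier χ Y k).det := by
    intro k
    -- The determinant upstairs is the product of those of the blocks, so each block is invertible.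
    have h := congrArg Matrix.det (hconj Y)
    rw [det_conj' ((isUnit_iff_isUnit_det V).2 hVunit), det_blockDiagonal, ← hYX] at h
    rw [h] at hY
    exact isUnit_of_dvd_unit (Finset.dvd_prod_of_mem
      (fun k => (blockFourier χ Y k).det) (Finset.mem_univ k)) hY
  refine ⟨fun k => hYF k ▸ hYunit k, ?_, ?_⟩
  · rw [map_inv_of_isUnit_det _ hVunit]
    simp only [propagator, hYX, ← hD, ← hYF]
    exact conj_smul_inv_map_eq_blockDiagonal hVunit rfl hYunit (hconj Y)
  · rw [map_inv_of_isUnit_det _ hVunit]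
    simp only [propagator, hYX, ← hD, ← hYF]
    exact conj_smul_inv_map_eq_blockDiagonal (isUnit_nonsing_inv_det _ hVunit)
      (nonsing_inv_nonsing_inv _ hVunit) (fun k => hYunit (-k)) (hconj' Y)
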